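/- **Notation.** Let $\mathbb{Q}(q^{1/4})$ be the field of rational functions in one variable $q^{1/4}$. Put $[k]=\dfrac{q^{k/2}-q^{-k/2}}{q^{1/2}-q^{-1/2}}$, $(q)_k=\prod_{l=1}^{k}(1-q^l)$ and $\binom{n}{k}_q=\dfrac{(q)_n}{(q)_k(q)_{n-k}}$ for $0\le k\le n$. Let $W_m$ be the $\mathbb{Q}(q^{1/4})$-vector space whose basis is the set of crossingless matchings of $m$ marked points on the boundary of a disk, by disjoint arcs inside the disk, up to isotopy fixing the boundary. The Kauffman bracket $\langle\,\cdot\,\rangle_2$ sends tangle diagrams in the disk with these $m$ end points to $W_m$. It is determined by two rules. A crossing whose overpassing strand has positive slope (runs from lower left to upper right) equals $q^{1/4}$ times its vertical smoothing $)($ plus $q^{-1/4}$ times its horizontal smoothing $\asymp$. A closed loop without crossings may be removed at the cost of the factor $-[2]$. A strand labelled $n$ stands for $n$ parallel strands. The clasps (Jones–Wenzl projectors) $P_n\in W_{n+n}$, regarded as webs on $n$ horizontal strands, are defined as follows. The projectors $P_0$ and $P_1$ are the trivial webs. For $n\ge 2$, with $P_{n-1}\otimes 1$ denoting $P_{n-1}$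 next to one further straight strand, and $U$ denoting the web in which the first $n-2$ strands are straight and the last two strands turn back on both sides, $$P_n=(P_{n-1}\otimes 1)+\frac{[n-1]}{[n]}\,(P_{n-1}\otimes 1)\,U\,(P_{n-1}\otimes 1).$$ **Proposition (full twist formula).** Let $n\ge 0$, and consider a disk with four groups of $n$ consecutive boundary points: lower left, upper left, lower right, upper right. Let $T_n\in W_{4n}$ be the bracket of the full twist of two $n$-strand bands running from left to right. That is, the two bands cross twice, and in both crossings the band going from upper left to lower right passes over the other one. For $0\le k\le n$, let $w_{n,k}\in W_{4n}$ be the crossingless web with - $k$ parallel arcs joining upper left to upper right, - $k$ parallel arcs joining lower left to lower right, - $n-k$ parallel arcs joining upper left to lower left, - $n-k$ parallel arcs joining upper right to lower right. For $w\in W_{4n}$ let $C(w)\in W_{4n}$ be the clasped web obtained by gluing a clasp $P_n$ to each of the four groups of end points of $w$, extended linearly in $w$ and in the clasps. Then $$C(T_n)=\sum_{k=0}^{n}(-1)^{n-k}\,q^{\frac{2k^2-n^2+k-n}{2}}\,\frac{(q)_n}{(q)_k}\binom{n}{k}_q\,C(w_{n,k}).$$ -/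

import Mathlib

noncomputable section

namespace A1Web

/-! The marked points of the disk `D_m` are numbered `0, …, m - 1` counterclockwise. In all comments
the disk is drawn as the upper half-plane (with a point at infinity), the marked points lying on the
real axis in increasing order from left to right. -/

/-- A basis web on `D_m`: a crossingless system of arcs in the disk joining the `m` marked points in
pairs, up to isotopy fixing the boundary. It is determined by the fixed-point-free involution
`mate`, and the involutions that occur are the noncrossing ones. -/
@[ext]
structure BasisWeb (m : ℕ) where
  mate : Fin m → Fin m
  mate_mate : ∀ x, mate (mate x) = x
  mate_ne : ∀ x, mate x ≠ x
  noncrossing : ∀ x y, ¬ (x < y ∧ y < mate x ∧ mate x < mate y)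

/-- The field `ℚ(q^{1/4})` of rational functions in one variable `q^{1/4}`. -/
abbrev K : Type := RatFunc ℚ

/-- The variable `q^{1/4}`. -/
def q4 : K := RatFunc.X

/-- The element `q`. -/
def q : K := q4 ^ 4

/-- `{k} = q^{k/2} - q^{-k/2}`. -/
def brace (k : ℤ) : K := q4 ^ (2 * k) - q4 ^ (-(2 * k))

/-- The quantum integer `[k] = {k} / {1}`. -/
def qInt (k : ℤ) : K := brace k / brace 1

/-- The `q`-Pochhammer symbol `(q)_k = (1 - q)(1 - q^2)⋯(1 - q^k)`. -/
def qPoch (k : ℕ) : K := ∏ l ∈ Finset.Icc 1 k, (1 - q ^ l)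

/-- The `q`-binomial coefficient `(q)_n / ((q)_k (q)_{n-k})`, which is `0` for `k > n`. -/
def qBinom (n k : ℕ) : K :=
  if k ≤ n then qPoch n / (qPoch k * qPoch (n - k)) else 0

/-- The `A_1` web space `W_m`: the vector space with basis the basis webs on `D_m`. -/
abbrev WebSpace (m : ℕ) : Type := BasisWeb m →₀ K

namespace BasisWeb

/-- The empty disk. -/
def empty : BasisWeb 0 where
  mate x := x
  mate_mate _ := rfl
  mate_ne x := x.elim0
  noncrossing x := x.elim0

/-- Order embedding of the old marked points when two new ones are created at places
`i` and `i + 1`. -/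
def ins {m : ℕ} (i : ℕ) (x : Fin m) : Fin (m + 2) :=
  if x.val < i then ⟨x.val, by omega⟩ else ⟨x.val + 2, by omega⟩

theorem val_ins {m : ℕ} (i : ℕ) (x : Fin m) :
    (ins i x).val = if x.val < i then x.val else x.val + 2 := by
  unfold ins; split_ifs <;> rfl

theorem eq_or_ins {m : ℕ} (i : ℕ) (hi : i ≤ m) (x : Fin (m + 2)) :
    x.val = i ∨ x.val = i + 1 ∨ ∃ y : Fin m, x = ins i y := by
  by_cases h0 : x.val = i
  · exact Or.inl h0
  by_cases h1 : x.val = i + 1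
  · exact Or.inr (Or.inl h1)
  refine Or.inr (Or.inr ?_)
  by_cases h : x.val < i
  · exact ⟨⟨x.val, by omega⟩, Fin.ext (by simp [val_ins, h])⟩
  · refine ⟨⟨x.val - 2, by omega⟩, Fin.ext ?_⟩
    rw [val_ins, if_neg (by simp only; omega)]
    simp only; omega

/-- The involution of `birth`. -/
def birthMate {m : ℕ} (i : ℕ) (hi : i ≤ m) (f : Fin m → Fin m) (x : Fin (m + 2)) : Fin (m + 2) :=
  if h : x.val < i then ins i (f ⟨x.val, by omega⟩)
  else if h0 : x.val = i then ⟨i + 1, by omega⟩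
  else if h1 : x.val = i + 1 then ⟨i, by omega⟩
  else ins i (f ⟨x.val - 2, by omega⟩)

theorem birthMate_ins {m : ℕ} (i : ℕ) (hi : i ≤ m) (f : Fin m → Fin m) (y : Fin m) :
    birthMate i hi f (ins i y) = ins i (f y) := by
  have hv := val_ins i y
  unfold birthMate
  split_ifs at hv with h
  · rw [dif_pos (by omega)]
    congr 2; exact Fin.ext hv
  · rw [dif_neg (by omega), dif_neg (by omega), dif_neg (by omega)]
    congr 2; apply Fin.ext; simp only; omega

theorem birthMate_left {m : ℕ} (i : ℕ) (hi : i ≤ m) (f : Fin m → Fin m) (x : Fin (m + 2))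
    (hx : x.val = i) : (birthMate i hi f x).val = i + 1 := by
  unfold birthMate
  rw [dif_neg (by omega), dif_pos hx]

theorem birthMate_right {m : ℕ} (i : ℕ) (hi : i ≤ m) (f : Fin m → Fin m) (x : Fin (m + 2))
    (hx : x.val = i + 1) : (birthMate i hi f x).val = i := by
  unfold birthMate
  rw [dif_neg (by omega), dif_neg (by omega), dif_pos hx]

/-- Create a new arc near the boundary, joining two new neighbouring marked points which get the
numbers `i` and `i + 1`. -/
def birth {m : ℕ} (i : ℕ) (hi : i ≤ m) (w : BasisWeb m) : BasisWeb (m + 2) where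
  mate := birthMate i hi w.mate
  mate_mate x := by
    rcases eq_or_ins i hi x with h | h | ⟨y, rfl⟩
    · apply Fin.ext
      rw [birthMate_right _ _ _ _ (birthMate_left _ _ _ _ h), h]
    · apply Fin.ext
      rw [birthMate_left _ _ _ _ (birthMate_right _ _ _ _ h), h]
    · rw [birthMate_ins, birthMate_ins, w.mate_mate]
  mate_ne x hx := by
    have hx' := congrArg Fin.val hx
    rcases eq_or_ins i hi x with h | h | ⟨y, rfl⟩
    · rw [birthMate_left _ _ _ _ h] at hx'; omega
    · rw [birthMate_right _ _ _ _ h] at hx'; omega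
    · rw [birthMate_ins, val_ins, val_ins] at hx'
      have := w.mate_ne y
      rw [Ne, Fin.ext_iff] at this
      split_ifs at hx' <;> omega
  noncrossing x y := by
    simp only [Fin.lt_def]
    rcases eq_or_ins i hi x with h | h | ⟨x, rfl⟩
    · rw [birthMate_left _ _ _ _ h]; omega
    · rw [birthMate_right _ _ _ _ h]; omega
    · rcases eq_or_ins i hi y with h | h | ⟨y, rfl⟩
      · rw [birthMate_left _ _ _ _ h, birthMate_ins, val_ins, val_ins]
        split_ifs <;> omega
      · rw [birthMate_right _ _ _ _ h]; omega
      · have := w.noncrossing x y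
        simp only [Fin.lt_def] at this
        rw [birthMate_ins, birthMate_ins, val_ins, val_ins, val_ins, val_ins]
        split_ifs <;> omega

/-- The involution of `turnback`. -/
def turnbackMate {m : ℕ} (i : ℕ) (hi : i + 1 < m) (f : Fin m → Fin m) (x : Fin m) : Fin m :=
  let a : Fin m := ⟨i, by omega⟩
  let b : Fin m := ⟨i + 1, hi⟩
  if x = a then b else if x = b then a
  else if f x = a then f b else if f x = b then f a else f x

/-- Arcs of a noncrossing matching do not separate each other. -/
theorem separate {m : ℕ} (w : BasisWeb m) (c u : Fin m) (h : u ≠ c) (h' : u ≠ w.mate c) :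
    ((c < u ↔ w.mate c < u) ↔ (c < w.mate u ↔ w.mate c < w.mate u)) := by
  obtain ⟨f, h1, h2, h3⟩ := w
  simp only at h' ⊢
  have e1 := h3 c u
  have e2 := h3 u c
  have e3 := h3 (f c) u
  have e4 := h3 u (f c)
  have e5 := h3 c (f u)
  have e6 := h3 (f u) c
  have e7 := h3 (f c) (f u)
  have e8 := h3 (f u) (f c)
  have n1 : f u ≠ c := fun e => h' (by rw [← e, h1])
  have n2 : f u ≠ f c := fun e => h (by rw [← h1 u, e, h1])
  simp only [h1, Fin.lt_def, ne_eq, Fin.ext_iff] at *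
  omega

theorem turnbackMate_noncrossing {m : ℕ} (i : ℕ) (hi : i + 1 < m) (w : BasisWeb m) (x y : Fin m) :
    ¬ (x < y ∧ y < turnbackMate i hi w.mate x ∧
      turnbackMate i hi w.mate x < turnbackMate i hi w.mate y) := by
  have h1 := w.mate_mate
  have sep := w.separate
  unfold turnbackMate
  simp only
  generalize ha : (⟨i, by omega⟩ : Fin m) = a
  generalize hb : (⟨i + 1, hi⟩ : Fin m) = b
  have hav : a.val = i := by rw [← ha]
  have hbv : b.val = i + 1 := by rw [← hb]
  have adj : ∀ u : Fin m, u ≠ a → u ≠ b → ((u < a ↔ u < b) ∧ (a < u ↔ b < u)) := by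
    intro u e1 e2
    simp only [ne_eq, Fin.ext_iff, Fin.lt_def] at *
    omega
  generalize hf : w.mate = f at *
  have hne : f x ≠ x := by rw [← hf]; exact w.mate_ne x
  have hnc : ¬ (x < y ∧ y < f x ∧ f x < f y) := by rw [← hf]; exact w.noncrossing x y
  have inj : ∀ u v, f u = f v → u = v := fun u v e => by rw [← h1 u, e, h1]
  rintro ⟨c1, c2, c3⟩
  by_cases xa : x = a
  · rw [if_pos xa] at c2
    simp only [Fin.lt_def, Fin.ext_iff] at *
    omega
  by_cases xb : x = b
  · rw [if_neg xa, if_pos xb] at c2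
    simp only [Fin.lt_def, Fin.ext_iff] at *
    omega
  rw [if_neg xa, if_neg xb] at c2 c3
  by_cases ya : y = a
  · rw [if_pos ya] at c3
    simp only [Fin.lt_def] at c1 c2 c3
    omega
  by_cases yb : y = b
  · rw [if_neg ya, if_pos yb] at c3
    simp only [Fin.lt_def] at c1 c2 c3
    omega
  rw [if_neg ya, if_neg yb] at c3
  have hxa : f x = a → x = f a := fun e => by rw [← e, h1]
  have hxb : f x = b → x = f b := fun e => by rw [← e, h1]
  have hya : f y = a → y = f a := fun e => by rw [← e, h1]
  have hyb : f y = b → y = f b := fun e => by rw [← e, h1]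
  have hab : f a = f b → a = b := inj a b
  have nab : a ≠ b := fun e => by rw [e] at hav; omega
  have sya := sep y a (Ne.symm ya)
  have syb := sep y b (Ne.symm yb)
  have sxa := sep x a (Ne.symm xa)
  have sxb := sep x b (Ne.symm xb)
  have ax := adj x xa xb
  have ay := adj y ya yb
  have afx := adj (f x)
  have afy := adj (f y)
  clear sep adj inj
  split_ifs at c2 c3 with k1 k2 k3 k4 k5
  all_goals simp only [Fin.lt_def, Fin.ext_iff, ne_eq] at *
  all_goals omega

/-- Join the ends number `i` and `i + 1` of a basis web by an arc, and then create a new arc with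
ends `i` and `i + 1`; a closed loop, which arises if `i` was joined to `i + 1`, is dropped. -/
def turnback {m : ℕ} (i : ℕ) (hi : i + 1 < m) (w : BasisWeb m) : BasisWeb m where
  mate := turnbackMate i hi w.mate
  mate_mate x := by
    have h1 := w.mate_mate
    have h2 := w.mate_ne
    have h3 : (⟨i, by omega⟩ : Fin m) ≠ ⟨i + 1, hi⟩ := by simp
    unfold turnbackMate
    grind
  mate_ne x := by
    have h1 := w.mate_mate
    have h2 := w.mate_ne
    have h3 : (⟨i, by omega⟩ : Fin m) ≠ ⟨i + 1, hi⟩ := by simp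
    unfold turnbackMate
    grind
  noncrossing x y := turnbackMate_noncrossing i hi w x y

/-- If `i` and `i + 1` are joined to each other, every other marked point is joined to one different
from these two. -/
theorem exists_ins_of_mate {m : ℕ} (i : ℕ) (hi : i ≤ m) (w : BasisWeb (m + 2))
    (hw : (w.mate ⟨i, by omega⟩).val = i + 1) (x : Fin m) :
    ∃ y : Fin m, w.mate (ins i x) = ins i y := by
  have hv := val_ins i x
  rcases eq_or_ins i hi (w.mate (ins i x)) with h | h | h
  · have h1 : w.mate (ins i x) = ⟨i, by omega⟩ := Fin.ext h
    have h2 := w.mate_mate (ins i x)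
    rw [h1] at h2
    rw [h2] at hw
    split_ifs at hv <;> omega
  · have h1 : w.mate (ins i x) = w.mate ⟨i, by omega⟩ := Fin.ext (h.trans hw.symm)
    have h2 := congrArg w.mate h1
    rw [w.mate_mate, w.mate_mate] at h2
    have h3 := congrArg Fin.val h2
    simp only at h3
    split_ifs at hv <;> omega
  · exact h

theorem ins_injective {m : ℕ} (i : ℕ) : Function.Injective (ins (m := m) i) := by
  intro x y h
  have h' := congrArg Fin.val h
  rw [val_ins, val_ins] at h'
  apply Fin.ext
  split_ifs at h' <;> omega

/-- Remove the arc joining the neighbouring marked points `i` and `i + 1`, together with these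
points; the other marked points are renumbered in order. -/
def removeArc {m : ℕ} (i : ℕ) (hi : i ≤ m) (w : BasisWeb (m + 2))
    (hw : (w.mate ⟨i, by omega⟩).val = i + 1) : BasisWeb m where
  mate x := (exists_ins_of_mate i hi w hw x).choose
  mate_mate x := by
    have h1 := (exists_ins_of_mate i hi w hw x).choose_spec
    have h2 := (exists_ins_of_mate i hi w hw
      (exists_ins_of_mate i hi w hw x).choose).choose_spec
    exact ins_injective i (h2.symm.trans ((congrArg w.mate h1.symm).trans (w.mate_mate _)))
  mate_ne x hx := by
    have h1 := (exists_ins_of_mate i hi w hw x).choose_spec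
    rw [hx] at h1
    exact w.mate_ne _ h1
  noncrossing x y := by
    have h1 := (exists_ins_of_mate i hi w hw x).choose_spec
    have h2 := (exists_ins_of_mate i hi w hw y).choose_spec
    have h := w.noncrossing (ins i x) (ins i y)
    rw [h1, h2] at h
    simp only [Fin.lt_def, val_ins] at h ⊢
    split_ifs at h <;> omega

end BasisWeb

/-! ### Linear operations on web spaces -/

/-- Create an arc with ends `i` and `i + 1` in every basis web. -/
def birth {m : ℕ} (i : ℕ) (hi : i ≤ m) : WebSpace m →ₗ[K] WebSpace (m + 2) :=
  Finsupp.linearCombination K fun w => Finsupp.single (w.birth i hi) 1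

open Classical in
/-- The scalar produced when the ends `i` and `i + 1` of `w` are joined: `-[2]` if this closes up a
loop, and `1` otherwise. -/
def loopFactor {m : ℕ} (i : ℕ) (hi : i + 1 < m) (w : BasisWeb m) : K :=
  if (w.mate ⟨i, by omega⟩).val = i + 1 then -qInt 2 else 1

/-- Join the ends `i` and `i + 1` by an arc, then create a new arc with ends `i` and `i + 1`; a
closed loop is replaced by the factor `-[2]`. -/
def turnback {m : ℕ} (i : ℕ) (hi : i + 1 < m) : WebSpace m →ₗ[K] WebSpace m :=
  Finsupp.linearCombination K fun w => Finsupp.single (w.turnback i hi) (loopFactor i hi w)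

/-- Join the ends `i` and `i + 1` by an arc; a closed loop is replaced by the factor `-[2]`. -/
def join {m : ℕ} (i : ℕ) (hi : i ≤ m) : WebSpace (m + 2) →ₗ[K] WebSpace m :=
  Finsupp.linearCombination K fun w =>
    Finsupp.single
      ((w.turnback i (by omega)).removeArc i hi (by simp [BasisWeb.turnback, BasisWeb.turnbackMate]))
      (loopFactor i (by omega) w)

/-! ### Tangle diagrams and the Kauffman bracket -/

/-- Tangle diagrams in `D_m`, presented by building them up from the empty disk, each step adding
one elementary piece next to the boundary (the real axis, below the part already drawn). Every
tangle diagram is isotopic to one of this form. -/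
inductive TangleDiagram : ℕ → Type
  /-- The empty diagram. -/
  | empty : TangleDiagram 0
  /-- Add an arc joining two new neighbouring marked points, which get the numbers `i`, `i + 1`. -/
  | birth {m : ℕ} (i : ℕ) (hi : i ≤ m) (D : TangleDiagram m) : TangleDiagram (m + 2)
  /-- Join the ends `i` and `i + 1` by an arc. -/
  | join {m : ℕ} (i : ℕ) (hi : i ≤ m) (D : TangleDiagram (m + 2)) : TangleDiagram m
  /-- Let the strands ending at `i` and `i + 1` cross; the strand running from the upper right to
  the lower left passes over the other one. -/
  | cross {m : ℕ} (i : ℕ) (hi : i + 1 < m) (D : TangleDiagram m) : TangleDiagram m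
  /-- Let the strands ending at `i` and `i + 1` cross; the strand running from the upper left to
  the lower right passes over the other one. -/
  | crossInv {m : ℕ} (i : ℕ) (hi : i + 1 < m) (D : TangleDiagram m) : TangleDiagram m

/-- The Kauffman bracket. A crossing whose overpassing strand is the one with positive slope is
`q^{1/4}` times the vertical smoothing (both strands go straight down) plus `q^{-1/4}` times the
horizontal smoothing (both strands turn back); for the other crossing the two coefficients are
exchanged. A closed loop is `-[2]`. -/
def bracket {m : ℕ} : TangleDiagram m → WebSpace m
  | .empty => Finsupp.single BasisWeb.empty 1
  | .birth i hi D => birth i hi (bracket D)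
  | .join i hi D => join i hi (bracket D)
  | .cross i hi D => q4 • bracket D + q4⁻¹ • turnback i hi (bracket D)
  | .crossInv i hi D => q4⁻¹ • bracket D + q4 • turnback i hi (bracket D)

namespace TangleDiagram

/-- The same diagram with the number of marked points rewritten. -/
def cast {m m' : ℕ} (h : m = m') (D : TangleDiagram m) : TangleDiagram m' := h ▸ D

/-- Add `l` parallel (that is, nested) arcs, whose `2 l` ends are inserted in front of the marked
point with number `p`. -/
def arcs {m : ℕ} (p : ℕ) (hp : p ≤ m) (D : TangleDiagram m) : (l : ℕ) → TangleDiagram (m + 2 * l)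
  | 0 => D
  | l + 1 => birth (m := m + 2 * l) (p + l) (by omega) (arcs p hp D l)

/-- Let the strand ending at `p` cross under its next `b` neighbours, which end at
`p + 1, …, p + b`. -/
def slide {m : ℕ} (p : ℕ) (D : TangleDiagram m) : (b : ℕ) → (hb : p + b < m) → TangleDiagram m
  | 0, _ => D
  | b + 1, hb => cross (p + b) (by omega) (slide p D b (by omega))

/-- Let `a` parallel strands ending at `p, …, p + a - 1` cross the `b` parallel strands ending at
`p + a, …, p + a + b - 1`. The latter strands, which run from the upper right to the lower left,
pass over the former ones. -/
def cableCross {m : ℕ} (p b : ℕ) : (a : ℕ) → (h : p + a + b ≤ m) → TangleDiagram m → TangleDiagram m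
  | 0, _, D => D
  | a + 1, h, D => cableCross p b a (by omega) (slide (p + a) D b (by omega))

/-- The full twist of two bands of `n` parallel strands. The marked points are, counterclockwise,
the `n` lower right, the `n` upper right, the `n` upper left and the `n` lower left ends: `2 n`
parallel strands run from left to right, and then the lower band and the upper band
cross twice at the right end. -/
def fullTwist (n : ℕ) : TangleDiagram (4 * n) :=
  cableCross 0 n n (by omega) (cableCross 0 n n (by omega)
    ((empty.arcs 0 le_rfl (2 * n)).cast (by omega)))

/-- The crossingless diagram in which the lower left and lower right ends are joined by `k` parallel
arcs, as are the upper left and upper right ends, and in which the upper right and lower right ends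
are joined by `n - k` parallel arcs, as are the upper left and lower left ends. The marked points
are numbered as in `fullTwist`. -/
def through (n k : ℕ) (hk : k ≤ n) : TangleDiagram (4 * n) :=
  (((empty.arcs 0 le_rfl (2 * k)).arcs k (by omega) (n - k)).arcs (k + 2 * (n - k) + 2 * k)
    (by omega) (n - k)).cast (by omega)

end TangleDiagram

/-! ### Clasps -/

/-- Glue the `A_1` clasp (Jones-Wenzl projector) on `n` strands to the ends `p, …, p + n - 1`. The
clasp on at most one strand is trivial, and the clasp on `n + 2` strands is the sum of
* the clasp on the first `n + 1` strands next to a straight strand, and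
* `[n + 1] / [n + 2]` times the clasp on the first `n + 1` strands, followed by the web in which the
  first `n` strands are straight and the last two turn back, followed by the clasp on the first
  `n + 1` strands. -/
def clasp {m : ℕ} (p : ℕ) : (n : ℕ) → (h : p + n ≤ m) → WebSpace m →ₗ[K] WebSpace m
  | 0, _ => LinearMap.id
  | 1, _ => LinearMap.id
  | n + 2, h =>
    clasp p (n + 1) (by omega) +
      (qInt (n + 1) / qInt (n + 2)) •
        (clasp p (n + 1) (by omega) ∘ₗ turnback (p + n) (by omega) ∘ₗ clasp p (n + 1) (by omega))

/-- Glue four clasps to a web on `D_{4n}`, one to each of the four groups of `n` consecutive marked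
points. The range of this map is the clasped web space `W_{(n,n,n,n)}`. -/
def clasped (n : ℕ) : WebSpace (4 * n) →ₗ[K] WebSpace (4 * n) :=
  clasp 0 n (by omega) ∘ₗ clasp n n (by omega) ∘ₗ
    clasp (2 * n) n (by omega) ∘ₗ clasp (3 * n) n (by omega)

end A1Web

end

/-!
Clasps kill turnbacks, so a strand that runs past its neighbours under a common clasp only picks up
powers of `q^{1/4}`. Peel one strand off the lower band of the twist. Once the two clasps of its own
band have straightened it there, it still winds around the upper band; expanding its crossings and
discarding all turnbacks inside a clasped band leaves two terms. In the first the strand is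
straight. In the second it turns back on both sides with the adjacent strand of the upper band, and
pulling these turnbacks through the diagram leaves a full twist with one strand fewer in each band.
Iterating gives a sum over the number of nested turnbacks, whose coefficients satisfy a recurrence
solved by products of `q`-Pochhammer symbols.

The marked points at the right ends of the bands are joined by nested arcs to those at the left
ends. A turnback slides along these arcs to its mirror image, so that the left clasps also kill
turnbacks that are attached at the right.
-/

noncomputable section

namespace A1Web

/-- The relation between the places of two disjoint pairs of neighbouring marked points: the first
pair is at the place `s`, and at `s'` once the other pair is removed, while the second pair is at
`t`, and at `t'` once the first one is removed. -/
inductive Apart : ℕ → ℕ → ℕ → ℕ → Prop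
  | left {i l : ℕ} (h : i ≤ l) : Apart i i (l + 2) l
  | right {i l : ℕ} (h : i ≤ l) : Apart (l + 2) l i i

theorem Apart.symm {s s' t t' : ℕ} : Apart s s' t t' → Apart t t' s s'
  | left h => right h
  | right h => left h

/-- The involution obtained from `f` when the points `a` and `b` are removed and the two arcs ending
there are joined. Its values at `a` and `b` are irrelevant. -/
def contract {X : Type*} [DecidableEq X] (f : X → X) (a b x : X) : X :=
  if f x = a then f b else if f x = b then f a else f x

section Contract

variable {X Y : Type*} [DecidableEq Y]

theorem contract_comm (f : Y → Y) (a b : Y) : contract f a b = contract f b a := by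
  funext x
  unfold contract
  grind

theorem contract_of_ne {f : Y → Y} {a b x : Y} (ha : f x ≠ a) (hb : f x ≠ b) :
    contract f a b x = f x := by
  rw [contract, if_neg ha, if_neg hb]

theorem map_contract [DecidableEq X] {e : X → Y} (he : Function.Injective e) {f : X → X} {g : Y → Y}
    (h : Function.Semiconj e f g) (a b x : X) :
    e (contract f a b x) = contract g (e a) (e b) (e x) := by
  simp only [contract, ← h.eq, he.eq_iff]
  split_ifs <;> rfl

theorem contract_contract_comm {f : Y → Y} (hf : Function.Involutive f) {a b c d x : Y}
    (hab : [a, b, c, d].Nodup) (hx : x ∉ [a, b, c, d]) :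
    contract (contract f c d) a b x = contract (contract f a b) c d x := by
  simp only [List.nodup_cons, List.mem_cons, List.not_mem_nil, not_or] at hab hx
  have ha := hf a
  have hb := hf b
  have hc := hf c
  have hd := hf d
  have hx' := hf x
  unfold contract
  grind

/-- An arc bent into a zigzag is straight: `e` and `e'` are two ways of naming the ends of `f` after
adding an arc between `b` and `c`, and differ only in that an end `x₀` of `f` is named `c` in the
former and `a` in the latter. -/
theorem contract_zigzag {f : X → X} {g : Y → Y} {e e' : X → Y} {x₀ : X} {a b c : Y}
    (he : ∀ x ≠ x₀, e x = e' x) (hc : e x₀ = c) (ha : e' x₀ = a)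
    (hg : Function.Semiconj e' f g) (hbc : g b = c) (hcb : g c = b)
    (hea : ∀ x, e x ≠ a) (heb : ∀ x, e x ≠ b) {x : X} (hf : f x ≠ x) :
    contract g a b (e x) = e (f x) := by
  rcases eq_or_ne x x₀ with rfl | hx
  · rw [he _ hf, hg.eq, ha, contract, hc, hcb, if_pos rfl]
    split_ifs with hba
    · rw [hba]
    · rfl
  have hgx : g (e x) = e' (f x) := by rw [he x hx, hg.eq]
  rcases eq_or_ne (f x) x₀ with hfx | hfx
  · rw [contract, hgx, hfx, ha, if_pos rfl, hbc, hc]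
  · rw [← he _ hfx] at hgx
    rw [contract_of_ne (hgx ▸ hea _) (hgx ▸ heb _), hgx]

end Contract

namespace BasisWeb

variable {m : ℕ}

theorem ins_ne_left (i : ℕ) (x : Fin m) {h : i < m + 2} : ins i x ≠ ⟨i, h⟩ := by
  rw [Ne, Fin.ext_iff, val_ins]
  simp only
  split_ifs <;> omega

theorem ins_ne_right (i : ℕ) (x : Fin m) {h : i + 1 < m + 2} : ins i x ≠ ⟨i + 1, h⟩ := by
  rw [Ne, Fin.ext_iff, val_ins]
  simp only
  split_ifs <;> omega

theorem ins_cases {i : ℕ} (hi : i ≤ m) {P : Fin (m + 2) → Prop} (left : P ⟨i, by omega⟩)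
    (right : P ⟨i + 1, by omega⟩) (old : ∀ y, P (ins i y)) (x : Fin (m + 2)) : P x := by
  rcases eq_or_ins i hi x with hx | hx | ⟨y, rfl⟩
  · rwa [show x = ⟨i, by omega⟩ from Fin.ext hx]
  · rwa [show x = ⟨i + 1, by omega⟩ from Fin.ext hx]
  · exact old y

theorem ext_ins (i : ℕ) {v w : BasisWeb m} (h : ∀ x, ins i (v.mate x) = ins i (w.mate x)) :
    v = w :=
  BasisWeb.ext (funext fun x => ins_injective i (h x))

section Apart

variable {s s' t t' : ℕ}

theorem ins_ins (h : Apart s s' t t') (x : Fin m) : ins t (ins s' x) = ins s (ins t' x) := by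
  apply Fin.ext
  cases h <;> simp only [val_ins] <;> split_ifs <;> omega

theorem ins_left (h : Apart s s' t t') (ht' : t' < m) :
    ins s ⟨t', ht'⟩ = ⟨t, by cases h <;> omega⟩ := by
  apply Fin.ext
  cases h <;> simp only [val_ins] <;> split_ifs <;> omega

theorem ins_right (h : Apart s s' t t') (ht' : t' + 1 < m) :
    ins s ⟨t' + 1, ht'⟩ = ⟨t + 1, by cases h <;> omega⟩ := by
  apply Fin.ext
  cases h <;> simp only [val_ins] <;> split_ifs <;> omega

end Apart

theorem birth_mate_ins {i : ℕ} (hi : i ≤ m) (w : BasisWeb m) (y : Fin m) :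
    (w.birth i hi).mate (ins i y) = ins i (w.mate y) :=
  birthMate_ins i hi w.mate y

theorem birth_mate_left {i : ℕ} (hi : i ≤ m) (w : BasisWeb m) {h : i < m + 2} :
    (w.birth i hi).mate ⟨i, h⟩ = ⟨i + 1, by omega⟩ :=
  Fin.ext (birthMate_left i hi w.mate _ rfl)

theorem birth_mate_right {i : ℕ} (hi : i ≤ m) (w : BasisWeb m) {h : i + 1 < m + 2} :
    (w.birth i hi).mate ⟨i + 1, h⟩ = ⟨i, by omega⟩ :=
  Fin.ext (birthMate_right i hi w.mate _ rfl)

theorem eq_birth {i : ℕ} (hi : i ≤ m) {w : BasisWeb (m + 2)} {v : BasisWeb m}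
    (hw : w.mate ⟨i, by omega⟩ = ⟨i + 1, by omega⟩)
    (h : ∀ y, w.mate (ins i y) = ins i (v.mate y)) : w = v.birth i hi := by
  refine BasisWeb.ext (funext fun x => ?_)
  induction x using ins_cases hi with
  | left => rw [hw, birth_mate_left]
  | right => rw [← hw, w.mate_mate, hw, birth_mate_right]
  | old y => rw [h, birth_mate_ins]

theorem birth_birth {s s' t t' : ℕ} (h : Apart s s' t t') {hs : s ≤ m + 2} {hs' : s' ≤ m}
    {ht : t ≤ m + 2} {ht' : t' ≤ m} (w : BasisWeb m) :
    (w.birth s' hs').birth t ht = (w.birth t' ht').birth s hs := by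
  apply eq_birth
  · rw [← ins_left h.symm (by omega), birth_mate_ins, birth_mate_left, ins_right h.symm]
  · intro y
    induction y using ins_cases ht' with
    | left => rw [ins_left h, birth_mate_left, birth_mate_left, ins_right h]
    | right => rw [ins_right h, birth_mate_right, birth_mate_right, ins_left h]
    | old y => rw [← ins_ins h, birth_mate_ins, birth_mate_ins, birth_mate_ins, ins_ins h]

/-- The basis web obtained from `w` by joining the ends `i` and `i + 1`; a closed loop is dropped.
This is the basis web underlying `A1Web.join`. -/
def join (i : ℕ) (hi : i ≤ m) (w : BasisWeb (m + 2)) : BasisWeb m :=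
  (w.turnback i (by omega)).removeArc i hi (by simp [turnback, turnbackMate])

theorem semiconj_removeArc {i : ℕ} (hi : i ≤ m) (w : BasisWeb (m + 2))
    (hw : (w.mate ⟨i, by omega⟩).val = i + 1) :
    Function.Semiconj (ins i) (w.removeArc i hi hw).mate w.mate :=
  fun x => (exists_ins_of_mate i hi w hw x).choose_spec.symm

theorem turnback_eq_birth_join {i : ℕ} (hi : i ≤ m) (w : BasisWeb (m + 2)) :
    w.turnback i (by omega) = (w.join i hi).birth i hi :=
  eq_birth hi (by simp [turnback, turnbackMate]) fun y => (semiconj_removeArc hi _ _ y).symm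

theorem semiconj_join {i : ℕ} (hi : i ≤ m) (w : BasisWeb (m + 2)) :
    Function.Semiconj (ins i) (w.join i hi).mate
      (contract w.mate ⟨i, by omega⟩ ⟨i + 1, by omega⟩) := by
  intro y
  rw [join, semiconj_removeArc hi]
  simp only [turnback, turnbackMate, if_neg (ins_ne_left i y), if_neg (ins_ne_right i y), contract]

theorem join_birth_self {i : ℕ} (hi : i ≤ m) (w : BasisWeb m) : (w.birth i hi).join i hi = w := by
  refine ext_ins i fun x => ?_
  have hx := birth_mate_ins hi w x
  rw [semiconj_join hi, contract_of_ne, hx] <;> rw [hx]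
  exacts [ins_ne_left _ _, ins_ne_right _ _]

theorem ins_succ_of_ne {i : ℕ} (hi : i < m) {x : Fin m} (hx : x ≠ ⟨i, hi⟩) :
    ins (i + 1) x = ins i x := by
  apply Fin.ext
  simp only [Ne, Fin.ext_iff, val_ins] at hx ⊢
  split_ifs <;> omega

theorem ins_self {i : ℕ} (hi : i < m) : ins i ⟨i, hi⟩ = ⟨i + 2, by omega⟩ :=
  Fin.ext (by simp [val_ins])

theorem ins_succ_self {i : ℕ} (hi : i < m) : ins (i + 1) ⟨i, hi⟩ = ⟨i, by omega⟩ :=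
  Fin.ext (by simp [val_ins])

theorem join_birth_succ {i : ℕ} (hi : i < m) (w : BasisWeb m) :
    (w.birth (i + 1) hi).join i hi.le = w :=
  ext_ins i fun x => (semiconj_join hi.le _ x).trans <|
    contract_zigzag (fun _ hx => (ins_succ_of_ne hi hx).symm) (ins_self hi) (ins_succ_self hi)
      (fun x => (birth_mate_ins hi w x).symm) (birth_mate_left hi w) (birth_mate_right hi w)
      (fun x => ins_ne_left i x) (fun x => ins_ne_right i x) (w.mate_ne x)

theorem join_succ_birth {i : ℕ} (hi : i < m) (w : BasisWeb m) :
    (w.birth i hi.le).join (i + 1) hi = w :=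
  ext_ins (i + 1) fun x => (semiconj_join hi _ x).trans <| by
    rw [contract_comm]
    exact contract_zigzag (fun _ hx => ins_succ_of_ne hi hx) (ins_succ_self hi) (ins_self hi)
      (fun x => (birth_mate_ins hi.le w x).symm) (birth_mate_right hi.le w)
      (birth_mate_left hi.le w) (fun x => ins_ne_right (i + 1) x)
      (fun x => ins_ne_left (i + 1) x) (w.mate_ne x)

section Apart

variable {s s' t t' : ℕ}

theorem nodup_ends (h : Apart s s' t t') {hs : s < m} {hs₁ : s + 1 < m} {ht : t < m}
    {ht₁ : t + 1 < m} :
    [(⟨s, hs⟩ : Fin m), ⟨s + 1, hs₁⟩, ⟨t, ht⟩, ⟨t + 1, ht₁⟩].Nodup := by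
  cases h <;> simp <;> omega

theorem join_birth (h : Apart s s' t t') {hs : s ≤ m + 2} {hs' : s' ≤ m} {ht : t ≤ m + 2}
    {ht' : t' ≤ m} (w : BasisWeb (m + 2)) :
    (w.birth t ht).join s hs = (w.join s' hs').birth t' ht' := by
  refine ext_ins s fun x => (semiconj_join hs _ x).trans ?_
  induction x using ins_cases ht' with
  | left =>
    rw [ins_left h, birth_mate_left, ins_right h, contract_of_ne, birth_mate_left] <;>
      simp only [birth_mate_left, ne_eq, Fin.mk.injEq] <;> cases h <;> omega
  | right =>
    rw [ins_right h, birth_mate_right, ins_left h, contract_of_ne, birth_mate_right] <;>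
      simp only [birth_mate_right, ne_eq, Fin.mk.injEq] <;> cases h <;> omega
  | old y =>
    rw [birth_mate_ins, ← ins_ins h, ← ins_ins h, semiconj_join hs',
      map_contract (ins_injective t) (fun x => (birth_mate_ins ht w x).symm), ins_left h.symm,
      ins_right h.symm]

theorem join_join (h : Apart s s' t t') {hs : s ≤ m + 2} {hs' : s' ≤ m} {ht : t ≤ m + 2}
    {ht' : t' ≤ m} (w : BasisWeb (m + 2 + 2)) :
    (w.join t ht).join s' hs' = (w.join s hs).join t' ht' := by
  refine ext_ins s' fun x => ins_injective t ?_
  rw [semiconj_join hs', map_contract (ins_injective t) (semiconj_join ht w), ins_left h.symm,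
    ins_right h.symm, ins_ins h, ins_ins h, semiconj_join ht',
    map_contract (ins_injective s) (semiconj_join hs w), ins_left h, ins_right h]
  refine contract_contract_comm w.mate_mate (nodup_ends h) ?_
  simp only [List.mem_cons, List.not_mem_nil, or_false, not_or]
  exact ⟨ins_ne_left _ _, ins_ne_right _ _, ins_ins h x ▸ ins_ne_left _ _,
    ins_ins h x ▸ ins_ne_right _ _⟩

end Apart

end BasisWeb

section LoopFactor

variable {m : ℕ}

theorem loopFactor_eq {i : ℕ} (hi : i + 1 < m) (w : BasisWeb m) :
    loopFactor i hi w = if w.mate ⟨i, by omega⟩ = ⟨i + 1, hi⟩ then -qInt 2 else 1 := by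
  simp only [loopFactor, Fin.ext_iff]

theorem loopFactor_birth_self {i : ℕ} (hi : i ≤ m) (w : BasisWeb m) :
    loopFactor i (by omega) (w.birth i hi) = -qInt 2 := by
  rw [loopFactor_eq, if_pos (w.birth_mate_left hi)]

theorem loopFactor_birth_succ {i : ℕ} (hi : i < m) (w : BasisWeb m) :
    loopFactor i (by omega) (w.birth (i + 1) hi) = 1 := by
  rw [loopFactor_eq, if_neg]
  intro h
  have hmate := (w.birth (i + 1) hi).mate_mate ⟨i, by omega⟩
  rw [h, BasisWeb.birth_mate_left, Fin.mk.injEq] at hmate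
  omega

theorem loopFactor_succ_birth {i : ℕ} (hi : i < m) (w : BasisWeb m) :
    loopFactor (i + 1) (by omega) (w.birth i hi.le) = 1 := by
  rw [loopFactor_eq, if_neg]
  rw [BasisWeb.birth_mate_right, Fin.mk.injEq]
  omega

variable {s s' t t' : ℕ}

theorem loopFactor_birth (h : Apart s s' t t') {hs : s ≤ m + 2} {hs' : s' ≤ m} {ht : t ≤ m + 2}
    (w : BasisWeb (m + 2)) :
    loopFactor s (by omega) (w.birth t ht) = loopFactor s' (by omega) w := by
  simp only [loopFactor_eq, ← BasisWeb.ins_left h.symm (m := m + 2) (by omega),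
    ← BasisWeb.ins_right h.symm (m := m + 2) (by omega), BasisWeb.birth_mate_ins,
    (BasisWeb.ins_injective t).eq_iff]

theorem loopFactor_join (h : Apart s s' t t') {hs : s ≤ m + 2} {hs' : s' ≤ m} {ht : t ≤ m + 2}
    (w : BasisWeb (m + 2 + 2)) :
    loopFactor s' (by omega) (w.join t ht) =
      if contract w.mate ⟨t, by omega⟩ ⟨t + 1, by omega⟩ ⟨s, by omega⟩ = ⟨s + 1, by omega⟩
      then -qInt 2 else 1 := by
  have hmate := (BasisWeb.ins_injective t).eq_iff (a := (w.join t ht).mate ⟨s', by omega⟩)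
    (b := ⟨s' + 1, by omega⟩)
  rw [BasisWeb.semiconj_join ht w, BasisWeb.ins_left h.symm, BasisWeb.ins_right h.symm] at hmate
  rw [loopFactor_eq, if_congr hmate.symm rfl rfl]

theorem loop_mul_contract_loop {X R : Type*} [DecidableEq X] [CommMonoid R] {f : X → X}
    (hf : Function.Involutive f) {a b c d : X} (hab : [a, b, c, d].Nodup) (δ : R) :
    (if f c = d then δ else 1) * (if contract f c d a = b then δ else 1) =
      (if f a = b then δ else 1) * (if contract f a b c = d then δ else 1) := by
  simp only [List.nodup_cons, List.mem_cons, List.not_mem_nil, not_or] at hab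
  have ha := hf a
  have hb := hf b
  have hc := hf c
  have hd := hf d
  unfold contract
  grind

theorem loopFactor_mul_loopFactor_join (h : Apart s s' t t') {hs : s ≤ m + 2} {hs' : s' ≤ m}
    {ht : t ≤ m + 2} {ht' : t' ≤ m} (w : BasisWeb (m + 2 + 2)) :
    loopFactor t (by omega) w * loopFactor s' (by omega) (w.join t ht) =
      loopFactor s (by omega) w * loopFactor t' (by omega) (w.join s hs) := by
  rw [loopFactor_join h (hs := hs) (hs' := hs'), loopFactor_join h.symm (hs := ht) (hs' := ht'),
    loopFactor_eq, loopFactor_eq]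
  exact loop_mul_contract_loop w.mate_mate (BasisWeb.nodup_ends h) _

end LoopFactor

variable {m : ℕ}

/-- `birth` at an arbitrary place; the junk value outside the disk is `0`. -/
def cup (i : ℕ) : WebSpace m →ₗ[K] WebSpace (m + 2) :=
  if hi : i ≤ m then birth i hi else 0

/-- `join` at an arbitrary place; the junk value outside the disk is `0`. -/
def cap (i : ℕ) : WebSpace (m + 2) →ₗ[K] WebSpace m :=
  if hi : i ≤ m then join i hi else 0

/-- `turnback` at an arbitrary place, the `i`-th generator of the Temperley-Lieb algebra; the junk
value outside the disk is `0`. -/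
def hook (i : ℕ) : Module.End K (WebSpace m) :=
  if hi : i + 1 < m then turnback i hi else 0

theorem birth_eq_cup {i : ℕ} (hi : i ≤ m) : birth i hi = cup i := (dif_pos hi).symm

theorem turnback_eq_hook {i : ℕ} (hi : i + 1 < m) : turnback i hi = hook i := (dif_pos hi).symm

theorem cup_of_lt {i : ℕ} (hi : m < i) : (cup i : WebSpace m →ₗ[K] _) = 0 :=
  dif_neg hi.not_ge

theorem cap_of_lt {i : ℕ} (hi : m < i) : (cap i : _ →ₗ[K] WebSpace m) = 0 :=
  dif_neg hi.not_ge

theorem hook_of_le {i : ℕ} (hi : m ≤ i + 1) : (hook i : Module.End K (WebSpace m)) = 0 :=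
  dif_neg (by omega)

theorem WebSpace.lhom_ext {V : Type*} [AddCommMonoid V] [Module K V] {f g : WebSpace m →ₗ[K] V}
    (h : ∀ w, f (Finsupp.single w 1) = g (Finsupp.single w 1)) : f = g :=
  Finsupp.lhom_ext' fun w => LinearMap.ext_ring (h w)

theorem cup_single {i : ℕ} (hi : i ≤ m) (w : BasisWeb m) :
    cup i (Finsupp.single w 1) = Finsupp.single (w.birth i hi) 1 := by
  simp [cup, hi, birth]

theorem cap_single {i : ℕ} (hi : i ≤ m) (w : BasisWeb (m + 2)) :
    cap i (Finsupp.single w 1) =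
      loopFactor i (by omega) w • Finsupp.single (w.join i hi) 1 := by
  simp [cap, hi, join, BasisWeb.join]

theorem hook_apply (i : ℕ) (x : WebSpace (m + 2)) : hook i x = cup i (cap i x) := by
  by_cases hi : i ≤ m
  · suffices hook i = cup i ∘ₗ cap i from DFunLike.congr_fun this x
    refine WebSpace.lhom_ext fun w => ?_
    rw [hook, dif_pos (by omega), turnback, Finsupp.linearCombination_single, one_smul,
      BasisWeb.turnback_eq_birth_join hi, LinearMap.comp_apply, cap_single hi, map_smul,
      cup_single hi, Finsupp.smul_single_one]
  · simp [hook, hi, cap_of_lt (not_le.1 hi)]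

theorem cap_cup_self {i : ℕ} (hi : i ≤ m) (x : WebSpace m) : cap i (cup i x) = -qInt 2 • x := by
  suffices cap i ∘ₗ cup i = -qInt 2 • LinearMap.id from DFunLike.congr_fun this x
  refine WebSpace.lhom_ext fun w => ?_
  simp [cup_single hi, cap_single hi, loopFactor_birth_self, BasisWeb.join_birth_self]

theorem cap_cup_succ {i : ℕ} (hi : i < m) (x : WebSpace m) : cap i (cup (i + 1) x) = x := by
  suffices cap i ∘ₗ cup (i + 1) = LinearMap.id from DFunLike.congr_fun this x
  refine WebSpace.lhom_ext fun w => ?_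
  simp [cup_single hi, cap_single hi.le, loopFactor_birth_succ hi, BasisWeb.join_birth_succ hi]

theorem cap_succ_cup {i : ℕ} (hi : i < m) (x : WebSpace m) : cap (i + 1) (cup i x) = x := by
  suffices cap (i + 1) ∘ₗ cup i = LinearMap.id from DFunLike.congr_fun this x
  refine WebSpace.lhom_ext fun w => ?_
  simp [cup_single hi.le, cap_single hi, loopFactor_succ_birth hi, BasisWeb.join_succ_birth hi]

section Apart

variable {s s' t t' : ℕ}

theorem Apart.inside_or_outside (h : Apart s s' t t') (m : ℕ) :
    s' ≤ m ∧ t' ≤ m ∧ s ≤ m + 2 ∧ t ≤ m + 2 ∨ (m < s' ∧ m + 2 < s) ∨ (m < t' ∧ m + 2 < t) := by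
  cases h <;> omega

theorem cup_cup (h : Apart s s' t t') (x : WebSpace m) : cup t (cup s' x) = cup s (cup t' x) := by
  rcases h.inside_or_outside m with ⟨hs', ht', hs, ht⟩ | ⟨hs', hs⟩ | ⟨ht', ht⟩
  · suffices cup t ∘ₗ cup s' = cup s ∘ₗ cup t' from DFunLike.congr_fun this x
    refine WebSpace.lhom_ext fun w => ?_
    simp [cup_single, hs', ht', hs, ht, BasisWeb.birth_birth h (ht := ht) (hs := hs) (ht' := ht')]
  · simp [cup_of_lt hs', cup_of_lt hs]
  · simp [cup_of_lt ht', cup_of_lt ht]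

theorem cap_cup (h : Apart s s' t t') (x : WebSpace (m + 2)) :
    cap s (cup t x) = cup t' (cap s' x) := by
  rcases h.inside_or_outside m with ⟨hs', ht', hs, ht⟩ | ⟨hs', hs⟩ | ⟨ht', ht⟩
  · suffices cap s ∘ₗ cup t = cup t' ∘ₗ cap s' from DFunLike.congr_fun this x
    refine WebSpace.lhom_ext fun w => ?_
    simp [-Finsupp.smul_single, cup_single, cap_single, hs', ht', hs, ht,
      loopFactor_birth h (hs := hs) (hs' := hs'), BasisWeb.join_birth h (hs' := hs') (ht' := ht')]
  · simp [cap_of_lt hs', cap_of_lt hs]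
  · simp [cup_of_lt ht', cup_of_lt ht]

theorem cap_cap (h : Apart s s' t t') (x : WebSpace (m + 2 + 2)) :
    cap s' (cap t x) = cap t' (cap s x) := by
  rcases h.inside_or_outside m with ⟨hs', ht', hs, ht⟩ | ⟨hs', hs⟩ | ⟨ht', ht⟩
  · suffices cap s' ∘ₗ cap t = cap t' ∘ₗ cap s from DFunLike.congr_fun this x
    refine WebSpace.lhom_ext fun w => ?_
    simp [-Finsupp.smul_single, cap_single, hs', ht', hs, ht, smul_smul,
      BasisWeb.join_join h (hs := hs) (ht' := ht'),
      loopFactor_mul_loopFactor_join h (hs := hs) (ht' := ht') (hs' := hs')]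
  · simp [cap_of_lt hs', cap_of_lt hs]
  · simp [cap_of_lt ht', cap_of_lt ht]

theorem hook_cup (h : Apart s s' t t') (x : WebSpace m) :
    hook s (cup t x) = cup t (hook s' x) := by
  rcases Nat.lt_or_ge m 2 with hm | hm
  · rw [hook_apply, hook_of_le (show m ≤ s' + 1 by omega)]
    obtain ht | hs : m < t ∨ m < s := by cases h <;> omega
    · simp [cup_of_lt ht]
    · simp [cap_of_lt hs]
  · obtain ⟨m, rfl⟩ := Nat.exists_eq_add_of_le' hm
    rw [hook_apply, hook_apply, cap_cup h, cup_cup h]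

theorem cap_hook (h : Apart s s' t t') (x : WebSpace (m + 2)) :
    cap s (hook t x) = hook t' (cap s x) := by
  rcases Nat.lt_or_ge m 2 with hm | hm
  · rw [hook_apply, hook_of_le (show m ≤ t' + 1 by omega)]
    obtain ht | hs : m < t ∨ m < s := by cases h <;> omega
    · simp [cup_of_lt ht]
    · simp [cap_of_lt hs]
  · obtain ⟨m, rfl⟩ := Nat.exists_eq_add_of_le' hm
    rw [hook_apply, hook_apply, cap_cup h, cap_cap h]

end Apart

section Scalars

theorem q4_ne_zero : q4 ≠ 0 := RatFunc.X_ne_zero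

theorem q4_pow_ne_one {k : ℕ} (hk : k ≠ 0) : q4 ^ k ≠ 1 := by
  intro h
  have hX : algebraMap (Polynomial ℚ) K (Polynomial.X ^ k) = algebraMap (Polynomial ℚ) K 1 := by
    rwa [map_pow, map_one, RatFunc.algebraMap_X]
  simpa [hk] using congrArg Polynomial.natDegree (RatFunc.algebraMap_injective ℚ hX)

theorem one_sub_q_pow_ne_zero {k : ℕ} (hk : k ≠ 0) : 1 - q ^ k ≠ 0 := by
  rw [q, ← pow_mul]
  exact sub_ne_zero.2 (q4_pow_ne_one (by omega)).symm

theorem brace_natCast (k : ℕ) : brace k = q4 ^ (2 * k) - (q4 ^ (2 * k))⁻¹ := by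
  rw [brace, zpow_neg]
  norm_cast

theorem brace_ne_zero {k : ℕ} (hk : k ≠ 0) : brace k ≠ 0 := by
  rw [brace_natCast, Ne, sub_eq_zero, ← mul_eq_one_iff_eq_inv₀ (pow_ne_zero _ q4_ne_zero),
    ← pow_add]
  exact q4_pow_ne_one (by omega)

theorem brace_one_ne_zero : brace 1 ≠ 0 := brace_ne_zero one_ne_zero

theorem qInt_ne_zero {k : ℕ} (hk : k ≠ 0) : qInt k ≠ 0 :=
  div_ne_zero (brace_ne_zero hk) brace_one_ne_zero

theorem qInt_two : qInt 2 = q4 ^ 2 + (q4 ^ 2)⁻¹ := by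
  have hq := q4_ne_zero
  rw [qInt, div_eq_iff brace_one_ne_zero, ← Nat.cast_one, ← Nat.cast_two, brace_natCast,
    brace_natCast]
  field_simp
  ring

theorem qInt_two_mul_qInt_succ (n : ℕ) :
    qInt 2 * qInt (n + 1 : ℕ) = qInt n + qInt (n + 2 : ℕ) := by
  have hq := q4_ne_zero
  rw [qInt_two, qInt, qInt, qInt, ← add_div, ← mul_div_assoc, brace_natCast, brace_natCast,
    brace_natCast]
  congr 1
  simp only [mul_add, pow_add]
  field_simp
  ring

end Scalars

section Smoothing

variable {F A : Type*} [Field F] [Ring A] [Algebra F A] {a : F} {U V : A}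

/-- The Kauffman bracket of a crossing with parameter `a`, where `U` is the web that replaces the
crossing by a turnback on either side. -/
def smoothing (a : F) (U : A) : A := a • 1 + a⁻¹ • U

theorem smoothing_mul_mul_smoothing (ha : a ≠ 0) (U V : A) :
    smoothing a U * V * smoothing a U =
      a ^ 2 • V + U * V + V * U + (a ^ 2)⁻¹ • (U * V * U) := by
  simp only [smoothing, add_mul, mul_add, smul_mul_assoc, mul_smul_comm, one_mul, mul_one]
  match_scalars <;> field_simp

theorem smoothing_mul_self (ha : a ≠ 0) (hU : U * U = -(a ^ 2 + (a ^ 2)⁻¹) • U) :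
    smoothing a U * smoothing a U = a ^ 2 • 1 + (1 - (a ^ 4)⁻¹) • U := by
  simp only [smoothing, add_mul, mul_add, smul_mul_assoc, mul_smul_comm, one_mul, mul_one, hU]
  match_scalars <;> field_simp
  ring

theorem smoothing_mul_smoothing_mul (ha : a ≠ 0) (hU : U * U = -(a ^ 2 + (a ^ 2)⁻¹) • U)
    (hUVU : U * V * U = U) : smoothing a U * smoothing a V * U = V * U := by
  simp only [smoothing, add_mul, mul_add, smul_mul_assoc, mul_smul_comm, one_mul, mul_one, hU, hUVU]
  match_scalars <;> field_simp
  ring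

theorem mul_smoothing_mul_smoothing (ha : a ≠ 0) (hV : V * V = -(a ^ 2 + (a ^ 2)⁻¹) • V)
    (hVUV : V * U * V = V) : V * (smoothing a U * smoothing a V) = V * U := by
  simp only [smoothing, add_mul, mul_add, smul_mul_assoc, mul_smul_comm, one_mul, mul_one,
    ← mul_assoc, hV, hVUV]
  match_scalars <;> field_simp
  ring

theorem semiconjBy_smoothing_mul_smoothing (ha : a ≠ 0)
    (hU : U * U = -(a ^ 2 + (a ^ 2)⁻¹) • U) (hV : V * V = -(a ^ 2 + (a ^ 2)⁻¹) • V)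
    (hUVU : U * V * U = U) (hVUV : V * U * V = V) :
    SemiconjBy (smoothing a U * smoothing a V) U V :=
  (smoothing_mul_smoothing_mul ha hU hUVU).trans (mul_smoothing_mul_smoothing ha hV hVUV).symm

end Smoothing

section TemperleyLieb

theorem cap_hook_self {i : ℕ} (hi : i ≤ m) (x : WebSpace (m + 2)) :
    cap i (hook i x) = -qInt 2 • cap i x := by
  rw [hook_apply, cap_cup_self hi]

theorem cap_eq_zero {i : ℕ} (hi : i ≤ m) {x : WebSpace (m + 2)} (hx : hook i x = 0) :
    cap i x = 0 := by
  have h := cap_hook_self hi x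
  rw [hx, map_zero, eq_comm, smul_eq_zero] at h
  exact h.resolve_left (neg_ne_zero.2 (qInt_ne_zero two_ne_zero))

theorem hook_mul_self (i : ℕ) :
    (hook i * hook i : Module.End K (WebSpace m)) = -(q4 ^ 2 + (q4 ^ 2)⁻¹) • hook i := by
  rcases le_or_gt m (i + 1) with hi | hi
  · simp [hook_of_le hi]
  · obtain ⟨m, rfl⟩ := Nat.exists_eq_add_of_le' (show 2 ≤ m by omega)
    refine LinearMap.ext fun x => ?_
    rw [Module.End.mul_apply, hook_apply i (hook i x), cap_hook_self (by omega), map_smul,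
      LinearMap.smul_apply, hook_apply, qInt_two]

theorem hook_commute {i k : ℕ} (h : i + 2 ≤ k) :
    Commute (hook i : Module.End K (WebSpace m)) (hook k) := by
  rcases Nat.lt_or_ge m 2 with hm | hm
  · simp [hook_of_le (show m ≤ i + 1 by omega)]
  · obtain ⟨m, rfl⟩ := Nat.exists_eq_add_of_le' hm
    obtain ⟨l, rfl⟩ := Nat.exists_eq_add_of_le' (show 2 ≤ k by omega)
    have hil : Apart i i (l + 2) l := .left (by omega)
    refine LinearMap.ext fun x => ?_
    rw [Module.End.mul_apply, Module.End.mul_apply, hook_apply i, hook_apply i x, cap_hook hil,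
      hook_cup hil.symm]

theorem hook_mul_hook_succ_mul_hook {i : ℕ} (hi : i + 2 < m) :
    (hook i * hook (i + 1) * hook i : Module.End K (WebSpace m)) = hook i := by
  obtain ⟨m, rfl⟩ := Nat.exists_eq_add_of_le' (show 2 ≤ m by omega)
  refine LinearMap.ext fun x => ?_
  simp only [Module.End.mul_apply, hook_apply]
  rw [cap_succ_cup (by omega), cap_cup_succ (by omega)]

theorem hook_succ_mul_hook_mul_hook_succ {i : ℕ} (hi : i + 2 < m) :
    (hook (i + 1) * hook i * hook (i + 1) : Module.End K (WebSpace m)) = hook (i + 1) := by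
  obtain ⟨m, rfl⟩ := Nat.exists_eq_add_of_le' (show 2 ≤ m by omega)
  refine LinearMap.ext fun x => ?_
  simp only [Module.End.mul_apply, hook_apply]
  rw [cap_cup_succ (by omega), cap_succ_cup (by omega)]

/-- The operator on webs that adds a positive crossing of the strands ending at `i` and `i + 1`. -/
def crossing (i : ℕ) : Module.End K (WebSpace m) := smoothing q4 (hook i)

theorem crossing_apply (i : ℕ) (x : WebSpace m) : crossing i x = q4 • x + q4⁻¹ • hook i x := rfl

theorem crossing_commute {i k : ℕ} (h : i + 2 ≤ k) :
    Commute (crossing i : Module.End K (WebSpace m)) (crossing k) := by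
  have one_left (x : Module.End K (WebSpace m)) : Commute (q4 • 1 : Module.End K (WebSpace m)) x :=
    (Commute.one_left x).smul_left q4
  exact (one_left _).add_left
    ((one_left _).symm.add_right ((((hook_commute h).smul_left _).smul_right _)))

theorem semiconjBy_crossing_mul_crossing_succ {i : ℕ} (hi : i + 2 < m) :
    SemiconjBy (crossing i * crossing (i + 1) : Module.End K (WebSpace m))
      (hook i) (hook (i + 1)) :=
  semiconjBy_smoothing_mul_smoothing q4_ne_zero (hook_mul_self _) (hook_mul_self _)
    (hook_mul_hook_succ_mul_hook hi) (hook_succ_mul_hook_mul_hook_succ hi)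

theorem semiconjBy_crossing_succ_mul_crossing {i : ℕ} (hi : i + 2 < m) :
    SemiconjBy (crossing (i + 1) * crossing i : Module.End K (WebSpace m))
      (hook (i + 1)) (hook i) :=
  semiconjBy_smoothing_mul_smoothing q4_ne_zero (hook_mul_self _) (hook_mul_self _)
    (hook_succ_mul_hook_mul_hook_succ hi) (hook_mul_hook_succ_mul_hook hi)

theorem cap_crossing_crossing {i : ℕ} (hi : i < m) (x : WebSpace (m + 2)) :
    cap (i + 1) (crossing i (crossing (i + 1) x)) = cap i x := by
  have hq := q4_ne_zero
  have loop_cancels :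
      q4 * q4 + (q4⁻¹ * (q4 * -(q4 ^ 2 + (q4 ^ 2)⁻¹)) + q4⁻¹ * q4⁻¹) = 0 := by
    field_simp
    ring
  simp only [crossing_apply, map_add, map_smul, smul_add, hook_apply]
  rw [cap_cup_self hi, cap_succ_cup hi, cap_succ_cup hi, cap_cup_succ hi, qInt_two]
  simp only [smul_smul]
  rw [mul_inv_cancel₀ hq, one_smul, ← add_smul, add_right_comm, ← add_smul, loop_cancels,
    zero_smul, zero_add]

end TemperleyLieb

section Slide

variable {M : Type*} [Monoid M] (σ : ℕ → M)

/-- The operator that slides the strand ending at `p` across its next `b` neighbours, where `σ i`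
is the operator that crosses the strands ending at `i` and `i + 1`. -/
def slideR (p : ℕ) : ℕ → M
  | 0 => 1
  | b + 1 => σ (p + b) * slideR p b

/-- The operator that slides the strand ending at `p + b` across the `b` neighbours in front of
it. -/
def slideL (p : ℕ) : ℕ → M
  | 0 => 1
  | b + 1 => slideL p b * σ (p + b)

/-- The operator that crosses the band of `a` strands ending at `p, p + 1, …` with the next `b`
strands, one strand of the former band after the other. -/
def bandCrossing (p b : ℕ) : ℕ → M
  | 0 => 1
  | a + 1 => bandCrossing p b a * slideR σ (p + a) b

/-- The full twist of the band of `a` strands ending at `p, p + 1, …` and the next `b` strands. -/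
def twist (p b : ℕ) : ℕ → M
  | 0 => 1
  | a + 1 => slideL σ (p + a) b * twist p b a * slideR σ (p + a) b

variable {σ}

theorem slideR_add (p a b : ℕ) : slideR σ p (a + b) = slideR σ (p + a) b * slideR σ p a := by
  induction b with
  | zero => rw [slideR, one_mul, add_zero]
  | succ b ih => rw [← add_assoc, slideR, ih, slideR, mul_assoc, add_assoc]

theorem slideL_add (p a b : ℕ) : slideL σ p (a + b) = slideL σ p a * slideL σ (p + a) b := by
  induction b with
  | zero => rw [slideL, mul_one, add_zero]
  | succ b ih => rw [← add_assoc, slideL, ih, slideL, mul_assoc, add_assoc]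

theorem slideR_one (p : ℕ) : slideR σ p 1 = σ p := mul_one _

theorem slideL_one (p : ℕ) : slideL σ p 1 = σ p := one_mul _

theorem slideR_succ' (p b : ℕ) : slideR σ p (b + 1) = slideR σ (p + 1) b * σ p := by
  rw [add_comm, slideR_add, slideR_one]

theorem slideL_succ' (p b : ℕ) : slideL σ p (b + 1) = σ p * slideL σ (p + 1) b := by
  rw [add_comm, slideL_add, slideL_one]

theorem commute_slideR {x : M} {p b : ℕ} (h : ∀ i < b, Commute x (σ (p + i))) :
    Commute x (slideR σ p b) := by
  induction b with
  | zero => exact Commute.one_right x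
  | succ b ih => exact (h b (by omega)).mul_right (ih fun i hi => h i (by omega))

theorem commute_slideL {x : M} {p b : ℕ} (h : ∀ i < b, Commute x (σ (p + i))) :
    Commute x (slideL σ p b) := by
  induction b with
  | zero => exact Commute.one_right x
  | succ b ih => exact (ih fun i hi => h i (by omega)).mul_right (h b (by omega))

theorem commute_bandCrossing {x : M} {p a b : ℕ} (h : ∀ i, i + 1 < a + b → Commute x (σ (p + i))) :
    Commute x (bandCrossing σ p b a) := by
  induction a with
  | zero => exact Commute.one_right x
  | succ a ih =>
    refine (ih fun i hi => h i (by omega)).mul_right (commute_slideR fun i hi => ?_)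
    rw [add_assoc]
    exact h (a + i) (by omega)

theorem bandCrossing_zero_left (p a : ℕ) : bandCrossing σ p 0 a = 1 := by
  induction a with
  | zero => rfl
  | succ a ih => rw [bandCrossing, ih, slideR, mul_one]

theorem twist_zero_left (p a : ℕ) : twist σ p 0 a = 1 := by
  induction a with
  | zero => rfl
  | succ a ih => rw [twist, ih, slideR, slideL, mul_one, mul_one]

theorem bandCrossing_succ_left (hσ : ∀ i k, i + 2 ≤ k → Commute (σ i) (σ k)) (p a b : ℕ) :
    bandCrossing σ p (b + 1) a = slideL σ (p + b) a * bandCrossing σ p b a := by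
  induction a with
  | zero => exact (mul_one _).symm
  | succ a ih =>
    have far : Commute (σ (p + b + a)) (bandCrossing σ p b a) :=
      commute_bandCrossing fun i _ => (hσ _ _ (by omega)).symm
    calc bandCrossing σ p (b + 1) a * (σ (p + a + b) * slideR σ (p + a) b)
        = slideL σ (p + b) a * (bandCrossing σ p b a * σ (p + b + a)) * slideR σ (p + a) b := by
          rw [ih, add_right_comm p a b]; simp only [mul_assoc]
      _ = slideL σ (p + b) a * σ (p + b + a) * (bandCrossing σ p b a * slideR σ (p + a) b) := by
          rw [← far.eq]; simp only [mul_assoc]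

theorem bandCrossing_mul_bandCrossing (hσ : ∀ i k, i + 2 ≤ k → Commute (σ i) (σ k)) (p a b : ℕ) :
    bandCrossing σ p a b * bandCrossing σ p b a = twist σ p b a := by
  induction a with
  | zero => rw [bandCrossing_zero_left, bandCrossing, twist, one_mul]
  | succ a ih =>
    rw [bandCrossing_succ_left hσ, bandCrossing, twist, ← ih]
    simp only [mul_assoc]

theorem twist_succ_left (hσ : ∀ i k, i + 2 ≤ k → Commute (σ i) (σ k)) (p a b : ℕ) :
    twist σ p (b + 1) a = slideR σ p a * twist σ (p + 1) b a * slideL σ p a := by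
  induction a with
  | zero => rw [twist, slideR, slideL, twist, one_mul, one_mul]
  | succ a ih =>
    have far {i j : ℕ} (hj : j < a) : Commute (σ (p + a + 1 + i)) (σ (p + j)) :=
      (hσ _ _ (by omega)).symm
    have hR : Commute (slideL σ (p + a + 1) b) (slideR σ p a) :=
      commute_slideR fun j hj => (commute_slideL fun i _ => (far hj).symm).symm
    have hL : Commute (slideR σ (p + a + 1) b) (slideL σ p a) :=
      commute_slideL fun j hj => (commute_slideR fun i _ => (far hj).symm).symm
    rw [twist, ih, slideL_succ', slideR_succ', slideR, slideL, twist, add_right_comm p 1 a]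
    calc σ (p + a) * slideL σ (p + a + 1) b *
          (slideR σ p a * twist σ (p + 1) b a * slideL σ p a) *
          (slideR σ (p + a + 1) b * σ (p + a))
        = σ (p + a) * (slideL σ (p + a + 1) b * slideR σ p a) * twist σ (p + 1) b a *
            (slideL σ p a * slideR σ (p + a + 1) b) * σ (p + a) := by simp only [mul_assoc]
      _ = σ (p + a) * slideR σ p a *
            (slideL σ (p + a + 1) b * twist σ (p + 1) b a * slideR σ (p + a + 1) b) *
            (slideL σ p a * σ (p + a)) := by rw [hR.eq, ← hL.eq]; simp only [mul_assoc]

end Slide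

/-- The linear map `L` carries the turnbacks of the `N` strands ending at `p, p + 1, …` to those of
the `N` strands ending at `p', p' + 1, …`. -/
def Intertwines {m m' : ℕ} (L : WebSpace m →ₗ[K] WebSpace m') (p p' N : ℕ) : Prop :=
  ∀ i, i + 1 < N → Function.Semiconj L (hook (p + i)) (hook (p' + i))

namespace Intertwines

variable {m m' p p' N : ℕ} {L : WebSpace m →ₗ[K] WebSpace m'}

theorem mono (h : Intertwines L p p' N) {k N' : ℕ} (hk : k + N' ≤ N) :
    Intertwines L (p + k) (p' + k) N' := by
  intro i hi
  rw [add_assoc, add_assoc]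
  exact h (k + i) (by omega)

theorem comp {m'' p'' : ℕ} {L' : WebSpace m' →ₗ[K] WebSpace m''} (h' : Intertwines L' p' p'' N)
    (h : Intertwines L p p' N) : Intertwines (L' ∘ₗ L) p p'' N :=
  fun i hi => (h' i hi).comp_left (h i hi)

theorem crossing (h : Intertwines L p p' N) {i : ℕ} (hi : i + 1 < N) (x : WebSpace m) :
    L (crossing (p + i) x) = A1Web.crossing (p' + i) (L x) := by
  rw [crossing_apply, crossing_apply, map_add, map_smul, map_smul, h i hi]

theorem slideR (h : Intertwines L p p' N) {b : ℕ} (hb : b < N) (x : WebSpace m) :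
    L (slideR A1Web.crossing p b x) = A1Web.slideR A1Web.crossing p' b (L x) := by
  induction b with
  | zero => rfl
  | succ b ih => exact (h.crossing hb _).trans (congrArg _ (ih (by omega)))

theorem slideL (h : Intertwines L p p' N) {b : ℕ} (hb : b < N) (x : WebSpace m) :
    L (slideL A1Web.crossing p b x) = A1Web.slideL A1Web.crossing p' b (L x) := by
  induction b generalizing x with
  | zero => rfl
  | succ b ih => exact (ih (by omega) _).trans (congrArg _ (h.crossing hb x))

theorem twist (h : Intertwines L p p' N) {a b : ℕ} (hN : a + b ≤ N) (x : WebSpace m) :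
    L (twist A1Web.crossing p b a x) = A1Web.twist A1Web.crossing p' b a (L x) := by
  induction a generalizing x with
  | zero => rfl
  | succ a ih =>
    have last : Intertwines L (p + a) (p' + a) (b + 1) := h.mono (by omega)
    simp only [A1Web.twist, Module.End.mul_apply]
    rw [last.slideL b.lt_succ_self, ih (by omega), last.slideR b.lt_succ_self]

end Intertwines

theorem hook_commute_crossing {i k : ℕ} (h : i + 2 ≤ k ∨ k + 2 ≤ i) :
    Commute (hook i : Module.End K (WebSpace m)) (crossing k) :=
  ((Commute.one_right _).smul_right q4).add_right
    ((h.elim hook_commute fun h => (hook_commute h).symm).smul_right _)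

theorem semiconjBy_slideR_hook {p b i : ℕ} (hi : i + 1 < b) (hb : p + b < m) :
    SemiconjBy (slideR crossing p b : Module.End K (WebSpace m))
      (hook (p + 1 + i)) (hook (p + i)) := by
  obtain ⟨c, rfl⟩ := Nat.exists_eq_add_of_lt hi
  have before : Commute (hook (p + 1 + i) : Module.End K (WebSpace m)) (slideR crossing p i) :=
    commute_slideR fun k hk => hook_commute_crossing (by omega)
  have after : Commute (hook (p + i) : Module.End K (WebSpace m))
      (slideR crossing (p + i + 1 + 1) c) :=
    commute_slideR fun k _ => hook_commute_crossing (by omega)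
  have here := semiconjBy_crossing_succ_mul_crossing (show p + i + 2 < m by omega)
  rw [add_right_comm p 1 i] at before ⊢
  rw [show i + 1 + c + 1 = i + (c + 1 + 1) by omega, slideR_add, slideR_succ', slideR_succ',
    mul_assoc (slideR crossing (p + i + 1 + 1) c)]
  exact (SemiconjBy.mul_left after.symm here).mul_left before.symm

theorem semiconjBy_slideL_hook {p b i : ℕ} (hi : i + 1 < b) (hb : p + b < m) :
    SemiconjBy (slideL crossing p b : Module.End K (WebSpace m))
      (hook (p + i)) (hook (p + 1 + i)) := by
  obtain ⟨c, rfl⟩ := Nat.exists_eq_add_of_lt hi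
  have before : Commute (hook (p + 1 + i) : Module.End K (WebSpace m)) (slideL crossing p i) :=
    commute_slideL fun k hk => hook_commute_crossing (by omega)
  have after : Commute (hook (p + i) : Module.End K (WebSpace m))
      (slideL crossing (p + i + 1 + 1) c) :=
    commute_slideL fun k _ => hook_commute_crossing (by omega)
  have here := semiconjBy_crossing_mul_crossing_succ (show p + i + 2 < m by omega)
  rw [add_right_comm p 1 i] at before ⊢
  rw [show i + 1 + c + 1 = i + (c + 1 + 1) by omega, slideL_add, slideL_succ', slideL_succ',
    ← mul_assoc (crossing (p + i))]
  exact SemiconjBy.mul_left before.symm (here.mul_left after.symm)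

theorem intertwines_slideR {p b : ℕ} (hb : p + b < m) :
    Intertwines (slideR crossing p b : Module.End K (WebSpace m)) (p + 1) p b :=
  fun _ hi => LinearMap.congr_fun (semiconjBy_slideR_hook hi hb)

theorem intertwines_slideL {p b : ℕ} (hb : p + b < m) :
    Intertwines (slideL crossing p b : Module.End K (WebSpace m)) p (p + 1) b :=
  fun _ hi => LinearMap.congr_fun (semiconjBy_slideL_hook hi hb)

/-- The turnbacks of the `N` strands ending at `p, p + 1, …` kill the vector `x`. -/
def Killed (x : WebSpace m) (p N : ℕ) : Prop := ∀ i, i + 1 < N → hook (p + i) x = 0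

/-- The linear map `φ` kills the turnbacks of the `N` strands ending at `p, p + 1, …`. -/
def Kills {V : Type*} [AddCommGroup V] [Module K V] (φ : WebSpace m →ₗ[K] V) (p N : ℕ) : Prop :=
  ∀ i, i + 1 < N → ∀ x, φ (hook (p + i) x) = 0

section Killed

variable {V : Type*} [AddCommGroup V] [Module K V] {φ : WebSpace m →ₗ[K] V} {x : WebSpace m}
  {p N : ℕ}

theorem Killed.mono (hx : Killed x p N) {k N' : ℕ} (hk : k + N' ≤ N) : Killed x (p + k) N' := by
  intro i hi
  rw [add_assoc]
  exact hx (k + i) (by omega)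

theorem Kills.mono (hφ : Kills φ p N) {k N' : ℕ} (hk : k + N' ≤ N) : Kills φ (p + k) N' := by
  intro i hi
  rw [add_assoc]
  exact hφ (k + i) (by omega)

theorem Intertwines.killed {m' p' : ℕ} {L : WebSpace m →ₗ[K] WebSpace m'}
    (hL : Intertwines L p p' N) (hx : Killed x p N) : Killed (L x) p' N := by
  intro i hi
  rw [← hL i hi, hx i hi, map_zero]

theorem Intertwines.kills {m' p' : ℕ} {L : WebSpace m' →ₗ[K] WebSpace m}
    (hL : Intertwines L p' p N) (hφ : Kills φ p N) : Kills (φ ∘ₗ L) p' N := by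
  intro i hi x
  rw [LinearMap.comp_apply, hL i hi, hφ i hi]

theorem Kills.comp {m' : ℕ} {L : WebSpace m →ₗ[K] WebSpace m'} (hL : Kills L p N)
    (φ : WebSpace m' →ₗ[K] V) : Kills (φ ∘ₗ L) p N := by
  intro i hi x
  rw [LinearMap.comp_apply, hL i hi, map_zero]

theorem Killed.twist {a b : ℕ} (h : p + a + b ≤ m) (hx : Killed x (p + a) b) :
    Killed (twist crossing p b a x) (p + a) b := by
  induction a generalizing x with
  | zero => exact hx
  | succ a ih =>
    rw [A1Web.twist, Module.End.mul_apply, Module.End.mul_apply]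
    refine (intertwines_slideL (by omega)).killed (ih (by omega) ?_)
    exact (intertwines_slideR (by omega)).killed hx

theorem Killed.slideR_apply {b : ℕ} (hx : Killed x p (b + 1)) :
    slideR crossing p b x = q4 ^ b • x := by
  induction b with
  | zero => rw [slideR, pow_zero, one_smul, Module.End.one_apply]
  | succ b ih =>
    rw [slideR, Module.End.mul_apply, ih (hx.mono (k := 0) (by omega)), map_smul, crossing_apply,
      hx b (by omega), smul_zero, add_zero, smul_smul, pow_succ]

theorem Killed.slideR_of_lt {a : ℕ} (hx : Killed x p N) {p' : ℕ} (h : p' + a < p) :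
    Killed (slideR crossing p' a x) p N := by
  intro i hi
  have far : Commute (hook (p + i) : Module.End K (WebSpace m)) (slideR crossing p' a) :=
    commute_slideR fun k hk => hook_commute_crossing (by omega)
  rw [← Module.End.mul_apply, far.eq, Module.End.mul_apply, hx i hi, map_zero]

theorem Kills.slideR_apply {b : ℕ} (hφ : Kills φ p (b + 1)) (x : WebSpace m) :
    φ (slideR crossing p b x) = q4 ^ b • φ x := by
  induction b with
  | zero => rw [slideR, pow_zero, one_smul, Module.End.one_apply]
  | succ b ih =>
    rw [slideR, Module.End.mul_apply, crossing_apply, map_add, map_smul, map_smul,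
      hφ b (by omega), smul_zero, add_zero, ih (hφ.mono (k := 0) (by omega)), smul_smul, pow_succ']

theorem map_crossing_hook_succ_crossing {i : ℕ} (hi : i + 2 < m) (hx : hook (i + 1) x = 0)
    (hφ : ∀ y, φ (hook (i + 1) y) = 0) :
    φ (crossing i (hook (i + 1) (crossing i x))) = (q4 ^ 2)⁻¹ • φ (hook i x) := by
  have h : (crossing i * hook (i + 1) * crossing i : Module.End K (WebSpace m)) = _ :=
    smoothing_mul_mul_smoothing q4_ne_zero (hook i) (hook (i + 1))
  rw [hook_mul_hook_succ_mul_hook hi] at h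
  have hx' := LinearMap.congr_fun h x
  simp only [Module.End.mul_apply, LinearMap.add_apply, LinearMap.smul_apply, hx, smul_zero,
    map_zero, zero_add] at hx'
  rw [hx', map_add, hφ, zero_add, map_smul]

theorem crossing_crossing (i : ℕ) (x : WebSpace m) :
    crossing i (crossing i x) = q4 ^ 2 • x + (1 - (q4 ^ 4)⁻¹) • hook i x :=
  LinearMap.congr_fun (smoothing_mul_self (U := hook i) q4_ne_zero (hook_mul_self i)) x

theorem map_slideL_hook_slideR {b : ℕ} (h : p + b + 1 < m) (hx : Killed x (p + 1) (b + 1))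
    (hφ : Kills φ (p + 1) (b + 1)) :
    φ (slideL crossing p b (hook (p + b) (slideR crossing p b x))) =
      (q4 ^ (2 * b))⁻¹ • φ (hook p x) := by
  induction b with
  | zero => simp [slideL, slideR]
  | succ b ih =>
    have commuteR : Commute (hook (p + b + 1) : Module.End K (WebSpace m)) (slideR crossing p b) :=
      commute_slideR fun i hi => hook_commute_crossing (by omega)
    have commuteL : Commute (hook (p + b + 1) : Module.End K (WebSpace m)) (slideL crossing p b) :=
      commute_slideL fun i hi => hook_commute_crossing (by omega)
    have hx' : hook (p + b + 1) (slideR crossing p b x) = 0 := by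
      rw [← Module.End.mul_apply, commuteR.eq, Module.End.mul_apply, add_right_comm,
        hx b (by omega), map_zero]
    have hφ' (y : WebSpace m) :
        (φ ∘ₗ slideL crossing p b : WebSpace m →ₗ[K] V) (hook (p + b + 1) y) = 0 := by
      rw [LinearMap.comp_apply, ← Module.End.mul_apply (slideL crossing p b), ← commuteL.eq,
        Module.End.mul_apply, add_right_comm, hφ b (by omega)]
    have removed := map_crossing_hook_succ_crossing (by omega) hx' hφ'
    rw [LinearMap.comp_apply, LinearMap.comp_apply] at removed
    rw [slideL, slideR, Module.End.mul_apply, Module.End.mul_apply, ← add_assoc, removed,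
      ih (by omega) (hx.mono (k := 0) (by omega)) (hφ.mono (k := 0) (by omega)), smul_smul,
      ← mul_inv, ← pow_add, mul_add, add_comm 2, mul_one]

theorem map_slideL_slideR {b : ℕ} (h : p + b < m) (hx : Killed x (p + 1) b)
    (hφ : Kills φ (p + 1) b) :
    φ (slideL crossing p b (slideR crossing p b x)) =
      q4 ^ (2 * b) • φ x + (brace b / q4 ^ 2) • φ (hook p x) := by
  induction b with
  | zero => simp [slideL, slideR, brace]
  | succ b ih =>
    have coeff : q4 ^ 2 * (brace b / q4 ^ 2) + (1 - (q4 ^ 4)⁻¹) * (q4 ^ (2 * b))⁻¹ =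
        brace (b + 1 : ℕ) / q4 ^ 2 := by
      have hq := q4_ne_zero
      rw [brace_natCast, brace_natCast, mul_add, pow_add]
      field_simp
      ring
    rw [slideL, slideR, Module.End.mul_apply, Module.End.mul_apply, crossing_crossing, map_add,
      map_add, map_smul, map_smul, map_smul, map_smul, map_slideL_hook_slideR (by omega) hx hφ,
      ih (by omega) (hx.mono (k := 0) (by omega)) (hφ.mono (k := 0) (by omega)), smul_add,
      smul_smul, smul_smul, smul_smul, add_assoc, ← add_smul, coeff, ← pow_add, mul_add, mul_one,
      add_comm 2]

end Killed

section CapSlide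

variable {p a : ℕ}

theorem slideR_succ_mul_slideR_succ (p a : ℕ) :
    (slideR crossing p (a + 1) * slideR crossing (p + 1) (a + 1) : Module.End K (WebSpace m)) =
      crossing (p + a) * crossing (p + a + 1) *
        (slideR crossing p a * slideR crossing (p + 1) a) := by
  have far : Commute (crossing (p + a + 1) : Module.End K (WebSpace m)) (slideR crossing p a) :=
    commute_slideR fun i hi => (crossing_commute (by omega)).symm
  calc crossing (p + a) * slideR crossing p a *
        (crossing (p + 1 + a) * slideR crossing (p + 1) a)
      = crossing (p + a) * (slideR crossing p a * crossing (p + a + 1)) *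
          slideR crossing (p + 1) a := by
        rw [add_right_comm p 1 a]; simp only [mul_assoc]
    _ = crossing (p + a) * crossing (p + a + 1) *
          (slideR crossing p a * slideR crossing (p + 1) a) := by
        rw [← far.eq]; simp only [mul_assoc]

theorem cap_slideR_slideR (h : p + a ≤ m) (x : WebSpace (m + 2)) :
    cap (p + a) (slideR crossing p a (slideR crossing (p + 1) a x)) = cap p x := by
  induction a with
  | zero => rfl
  | succ a ih =>
    rw [← Module.End.mul_apply, slideR_succ_mul_slideR_succ, Module.End.mul_apply,
      Module.End.mul_apply, Module.End.mul_apply, ← add_assoc, cap_crossing_crossing (by omega),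
      ih (by omega)]

theorem cap_slideL {x : WebSpace (m + 2)} (h : p + a ≤ m) (hx : ∀ i < a, cap (p + i) x = 0) :
    cap p (slideL crossing (p + 1) a x) = (q4 ^ a)⁻¹ • cap (p + a) x := by
  induction a generalizing x with
  | zero => simp [slideL]
  | succ a ih =>
    rw [slideL, Module.End.mul_apply, ih (by omega), crossing_apply, map_add, map_smul, map_smul,
      hx a (by omega), smul_zero, zero_add, hook_apply, add_right_comm p 1 a,
      cap_cup_succ (by omega), smul_smul, pow_succ, mul_inv, add_assoc]
    intro i hi
    obtain ⟨l, rfl⟩ := Nat.exists_eq_add_of_lt hi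
    have outer : Apart (p + i) (p + i) (p + i + l + 2) (p + i + l) := .left (by omega)
    rw [crossing_apply, map_add, map_smul, map_smul, hx i (by omega),
      show p + 1 + (i + l + 1) = p + i + l + 2 by omega, cap_hook outer, hx i (by omega), map_zero,
      smul_zero, smul_zero, add_zero]

theorem intertwines_cap_right (p N : ℕ) :
    Intertwines (cap p : WebSpace (m + 2) →ₗ[K] WebSpace m) (p + 2) p N := by
  intro i _ x
  rw [add_right_comm]
  exact cap_hook (.left (by omega)) x

theorem intertwines_cap_left (p N : ℕ) :
    Intertwines (cap (p + N) : WebSpace (m + 2) →ₗ[K] WebSpace m) p p N := by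
  intro i hi x
  obtain ⟨k, rfl⟩ := Nat.exists_eq_add_of_lt hi
  rw [show p + (i + 1 + k + 1) = p + i + k + 2 by omega]
  exact cap_hook (.right (show p + i ≤ p + i + k by omega)) x

theorem intertwines_cup_right (p N : ℕ) :
    Intertwines (cup p : WebSpace m →ₗ[K] WebSpace (m + 2)) p (p + 2) N := by
  intro i _ x
  rw [add_right_comm]
  exact (hook_cup (.right (by omega)) x).symm

theorem intertwines_cup_left (p N : ℕ) :
    Intertwines (cup (p + N) : WebSpace m →ₗ[K] WebSpace (m + 2)) p p N := by
  intro i hi x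
  obtain ⟨k, rfl⟩ := Nat.exists_eq_add_of_lt hi
  rw [show p + (i + 1 + k + 1) = p + i + k + 2 by omega]
  exact (hook_cup (.left (show p + i ≤ p + i + k by omega)) x).symm

theorem cap_slideR_twist {b : ℕ} {x : WebSpace (m + 2)} (h : p + a ≤ m)
    (hx : Killed x p (a + 1)) :
    cap (p + a) (slideR crossing p a (twist crossing (p + 1) (b + 1) a x)) =
      (q4 ^ a)⁻¹ • twist crossing p b a (cap (p + a) x) := by
  have adjacent_caps : ∀ i < a, cap (p + i) x = 0 := fun i hi =>
    cap_eq_zero (by omega) (hx i (by omega))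
  rw [twist_succ_left fun _ _ => crossing_commute, Module.End.mul_apply, Module.End.mul_apply,
    cap_slideR_slideR h, (intertwines_cap_right p _).twist le_rfl, cap_slideL h adjacent_caps,
    map_smul]

end CapSlide

section TwistCoeff

/-- The `q`-shifted factorial `(q⁻ᵃ; q)ⱼ` up to the sign `(-1)ʲ`; it vanishes for `a < j`. -/
def qShiftedPoch (a j : ℕ) : K := ∏ l ∈ Finset.range j, (q ^ l / q ^ a - 1)

/-- The coefficient of the web with `j` nested turnbacks in the full twist of clasped bands of `a`
and `b` strands. -/
def twistCoeff (a b j : ℕ) : K :=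
  q4 ^ (2 * (a * b)) * (-q4 ^ 2) ^ j * qShiftedPoch a j * qShiftedPoch b j / qPoch j

theorem q_ne_zero : q ≠ 0 := pow_ne_zero _ q4_ne_zero

theorem qShiftedPoch_succ (a j : ℕ) :
    qShiftedPoch a (j + 1) = qShiftedPoch a j * (q ^ j / q ^ a - 1) :=
  Finset.prod_range_succ _ _

theorem qShiftedPoch_succ_succ (a j : ℕ) :
    qShiftedPoch (a + 1) (j + 1) = qShiftedPoch a j * (1 / q ^ (a + 1) - 1) := by
  rw [qShiftedPoch, Finset.prod_range_succ', pow_zero]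
  refine congrArg (· * _) (Finset.prod_congr rfl fun l _ => ?_)
  rw [pow_succ, pow_succ, mul_div_mul_right _ _ q_ne_zero]

theorem qShiftedPoch_eq_zero {a j : ℕ} (h : a < j) : qShiftedPoch a j = 0 :=
  Finset.prod_eq_zero (Finset.mem_range.2 h)
    (sub_eq_zero.2 (div_self (pow_ne_zero _ q_ne_zero)))

theorem qPoch_succ (k : ℕ) : qPoch (k + 1) = qPoch k * (1 - q ^ (k + 1)) :=
  Finset.prod_Icc_succ_top (by omega) _

theorem qPoch_ne_zero (k : ℕ) : qPoch k ≠ 0 :=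
  Finset.prod_ne_zero_iff.2 fun _ hl =>
    one_sub_q_pow_ne_zero (Nat.one_le_iff_ne_zero.1 (Finset.mem_Icc.1 hl).1)

theorem twistCoeff_zero (a b : ℕ) : twistCoeff a b 0 = q4 ^ (2 * (a * b)) := by
  simp [twistCoeff, qShiftedPoch, qPoch]

theorem twistCoeff_eq_zero_left {a j : ℕ} (h : a < j) (b : ℕ) : twistCoeff a b j = 0 := by
  simp [twistCoeff, qShiftedPoch_eq_zero h]

theorem twistCoeff_eq_zero_right {b j : ℕ} (h : b < j) (a : ℕ) : twistCoeff a b j = 0 := by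
  simp [twistCoeff, qShiftedPoch_eq_zero h]

theorem twistCoeff_succ_succ (a b j : ℕ) :
    twistCoeff (a + 1) (b + 1) (j + 1) = q4 ^ (2 * (b + 1)) * twistCoeff a (b + 1) (j + 1) +
      (q4 ^ (2 * a))⁻¹ * (brace (b + 1 : ℕ) / q4 ^ 2) * twistCoeff a b j := by
  have hq4 := q4_ne_zero
  have hP := qPoch_ne_zero j
  have hJ := one_sub_q_pow_ne_zero j.succ_ne_zero
  simp only [twistCoeff, qShiftedPoch_succ_succ, qShiftedPoch_succ, qPoch_succ, brace_natCast]
  simp only [q, ← pow_mul] at hJ ⊢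
  rw [div_eq_iff (mul_ne_zero hP hJ)]
  field_simp
  ring

end TwistCoeff

section TwistExpansion

variable {V : Type*} [AddCommGroup V] [Module K V]

/-- The operator joining the `j` strands that end just below position `M` to the `j` strands from
`M` on, by nested turnbacks on both sides; zero where these strands are not all present. -/
def nestedTurnback : (j M m : ℕ) → WebSpace m →ₗ[K] WebSpace m
  | 0, _, _ => LinearMap.id
  | j + 1, M + 1, m + 2 => cup M ∘ₗ nestedTurnback j M m ∘ₗ cap M
  | _, _, _ => 0

/-- The situation of a full twist between clasped bands: the first `a` strands from position `p` on
and the next `b` strands carry clasps both on the side of `x` and on the side of `φ`. -/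
structure ClaspedBands (p a b : ℕ) (x : WebSpace m) (φ : WebSpace m →ₗ[K] V) : Prop where
  fits : p + a + b ≤ m
  killed_left : Killed x p a
  killed_right : Killed x (p + a) b
  kills_left : Kills φ p a
  kills_right : Kills φ (p + a) b

variable {p a b : ℕ}

theorem ClaspedBands.peel {x : WebSpace m} {φ : WebSpace m →ₗ[K] V}
    (h : ClaspedBands p (a + 1) b x φ) : ClaspedBands (p + 1) a b x φ where
  fits := by have := h.fits; omega
  killed_left := h.killed_left.mono (by omega)
  killed_right := by rw [add_assoc, add_comm 1]; exact h.killed_right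
  kills_left := h.kills_left.mono (by omega)
  kills_right := by rw [add_assoc, add_comm 1]; exact h.kills_right

theorem ClaspedBands.cap_cup {x : WebSpace (m + 2)} {φ : WebSpace (m + 2) →ₗ[K] V}
    (h : ClaspedBands p (a + 1) (b + 1) x φ) :
    ClaspedBands p a b (cap (p + a) x) (φ ∘ₗ cup (p + a)) where
  fits := by have := h.fits; omega
  killed_left := (intertwines_cap_left p a).killed (h.killed_left.mono (k := 0) (by omega))
  killed_right := (intertwines_cap_right (p + a) b).killed
    (h.killed_right.mono (k := 1) (by omega))
  kills_left := (intertwines_cup_left p a).kills (h.kills_left.mono (k := 0) (by omega))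
  kills_right := (intertwines_cup_right (p + a) b).kills
    (h.kills_right.mono (k := 1) (by omega))

theorem ClaspedBands.twist_succ {x : WebSpace m} {φ : WebSpace m →ₗ[K] V}
    (h : ClaspedBands p (a + 1) b x φ) :
    φ (twist crossing p b (a + 1) x) =
      q4 ^ (2 * b) • φ (twist crossing (p + 1) b a x) +
        ((q4 ^ a)⁻¹ * (brace b / q4 ^ 2)) •
          φ (hook (p + a) (slideR crossing p a (twist crossing (p + 1) b a x))) := by
  have fits := h.fits
  set y := twist crossing (p + 1) b a x
  have slid_killed : Killed (slideR crossing p a y) (p + a + 1) b :=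
    add_right_comm p 1 a ▸
      (h.peel.killed_right.twist h.peel.fits).slideR_of_lt (add_right_comm p 1 a).ge
  have scaled : q4 ^ a • φ (twist crossing p b (a + 1) x) =
      q4 ^ (2 * b) • q4 ^ a • φ y +
        (brace b / q4 ^ 2) • φ (hook (p + a) (slideR crossing p a y)) := by
    calc
      _ = φ (slideL crossing (p + a) b (twist crossing p b a (slideR crossing p (a + b) x))) := by
        rw [slideR_add, Module.End.mul_apply, h.killed_left.slideR_apply, map_smul, map_smul,
          map_smul, map_smul, twist, Module.End.mul_apply, Module.End.mul_apply]
      _ = φ (slideL crossing (p + a) b (slideR crossing (p + a) b (slideR crossing p a y))) := by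
        rw [← (intertwines_slideR (by omega)).twist le_rfl, slideR_add, Module.End.mul_apply]
      _ = _ := by
        rw [map_slideL_slideR (by omega) slid_killed h.kills_right, h.kills_left.slideR_apply]
  rw [← inv_smul_smul₀ (pow_ne_zero a q4_ne_zero) (φ (twist crossing p b (a + 1) x)), scaled,
    smul_add, smul_comm, inv_smul_smul₀ (pow_ne_zero a q4_ne_zero), smul_smul]

theorem ClaspedBands.twist_succ_succ {x : WebSpace (m + 2)} {φ : WebSpace (m + 2) →ₗ[K] V}
    (h : ClaspedBands p (a + 1) (b + 1) x φ) :
    φ (twist crossing p (b + 1) (a + 1) x) =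
      q4 ^ (2 * (b + 1)) • φ (twist crossing (p + 1) (b + 1) a x) +
        ((q4 ^ (2 * a))⁻¹ * (brace (b + 1 : ℕ) / q4 ^ 2)) •
          φ (cup (p + a) (twist crossing p b a (cap (p + a) x))) := by
  have fits := h.fits
  rw [h.twist_succ, hook_apply, cap_slideR_twist (by omega) h.killed_left, map_smul, map_smul,
    smul_smul, two_mul a, pow_add, mul_inv, mul_right_comm]

theorem sum_twistCoeff_succ_succ (r : ℕ → V) :
    ∑ j ∈ Finset.range (a + 2), twistCoeff (a + 1) (b + 1) j • r j =
      q4 ^ (2 * (b + 1)) • ∑ j ∈ Finset.range (a + 1), twistCoeff a (b + 1) j • r j +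
        ((q4 ^ (2 * a))⁻¹ * (brace (b + 1 : ℕ) / q4 ^ 2)) •
          ∑ j ∈ Finset.range (a + 1), twistCoeff a b j • r (j + 1) := by
  have extend : ∑ j ∈ Finset.range (a + 1), twistCoeff a (b + 1) j • r j =
      ∑ j ∈ Finset.range (a + 2), twistCoeff a (b + 1) j • r j := by
    rw [Finset.sum_range_succ _ (a + 1), twistCoeff_eq_zero_left a.lt_succ_self, zero_smul,
      add_zero]
  have coeff_zero :
      twistCoeff (a + 1) (b + 1) 0 = q4 ^ (2 * (b + 1)) * twistCoeff a (b + 1) 0 := by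
    simp only [twistCoeff_zero]
    ring
  simp only [extend, Finset.sum_range_succ' _ (a + 1), coeff_zero, twistCoeff_succ_succ, add_smul,
    Finset.sum_add_distrib, smul_add, Finset.smul_sum, smul_smul]
  exact add_right_comm _ _ _

theorem ClaspedBands.twist_eq_sum (a : ℕ) {b m p : ℕ} {x : WebSpace m} {φ : WebSpace m →ₗ[K] V}
    (h : ClaspedBands p a b x φ) :
    φ (twist crossing p b a x) =
      ∑ j ∈ Finset.range (a + 1), twistCoeff a b j • φ (nestedTurnback j (p + a) m x) := by
  induction a generalizing b m p with
  | zero => simp [twistCoeff_zero, nestedTurnback, twist]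
  | succ a ih =>
    have peeled := ih h.peel
    rw [add_right_comm, add_assoc] at peeled
    cases b with
    | zero =>
      rw [twist_zero_left, Finset.sum_eq_single 0 (fun j _ hj => by
        rw [twistCoeff_eq_zero_right (by omega), zero_smul]) (by simp)]
      simp [twistCoeff_zero, nestedTurnback]
    | succ b =>
      have fits := h.fits
      obtain ⟨m, rfl⟩ := Nat.exists_eq_add_of_le' (show 2 ≤ m by omega)
      rw [h.twist_succ_succ, peeled, sum_twistCoeff_succ_succ]
      exact congrArg (_ + _ • ·) (ih h.cap_cup)

end TwistExpansion

section Clasp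

variable {V : Type*} [AddCommGroup V] [Module K V]

theorem clasp_add_two (p n : ℕ) (h : p + (n + 2) ≤ m) (x : WebSpace m) :
    clasp p (n + 2) h x = clasp p (n + 1) (by omega) x +
      (qInt (n + 1 : ℕ) / qInt (n + 2 : ℕ)) •
        clasp p (n + 1) (by omega) (hook (p + n) (clasp p (n + 1) (by omega) x)) := by
  rw [← turnback_eq_hook (by omega), clasp]
  rfl

theorem Intertwines.clasp {m' p p' n : ℕ} {L : WebSpace m →ₗ[K] WebSpace m'}
    (hL : Intertwines L p p' n) (h : p + n ≤ m) (h' : p' + n ≤ m') (x : WebSpace m) :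
    L (clasp p n h x) = A1Web.clasp p' n h' (L x) := by
  induction n using Nat.twoStepInduction generalizing x with
  | zero => rfl
  | one => rfl
  | more n _ ih =>
    have smaller := ih (hL.mono (k := 0) (by omega)) (by omega) (by omega)
    rw [clasp_add_two, clasp_add_two, map_add, map_smul, smaller, smaller, hL n (by omega), smaller]

theorem clasp_hook {p n i : ℕ} (h : p + n ≤ m) (hi : i + 2 ≤ p ∨ p + n ≤ i) (x : WebSpace m) :
    clasp p n h (hook i x) = hook i (clasp p n h x) := by
  have far : Intertwines (hook i : WebSpace m →ₗ[K] WebSpace m) p p n := fun k hk =>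
    LinearMap.congr_fun (hi.elim (fun hi => hook_commute (show i + 2 ≤ p + k by omega))
      fun hi => (hook_commute (show p + k + 2 ≤ i by omega)).symm)
  exact (far.clasp h h x).symm

theorem intertwines_clasp {p n p' N : ℕ} (h : p + n ≤ m) (hp : p' + N ≤ p ∨ p + n ≤ p') :
    Intertwines (clasp p n h) p' p' N :=
  fun _ _ => clasp_hook h (by omega)

theorem Kills.clasp_apply {φ : WebSpace m →ₗ[K] V} {p n : ℕ} (hφ : Kills φ p n) (h : p + n ≤ m)
    (x : WebSpace m) : φ (clasp p n h x) = φ x := by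
  induction n using Nat.twoStepInduction generalizing x with
  | zero => rfl
  | one => rfl
  | more n _ ih =>
    have smaller := ih (hφ.mono (k := 0) (by omega)) (by omega)
    rw [clasp_add_two, map_add, map_smul, smaller, smaller, hφ n (by omega), smul_zero, add_zero]

theorem neg_qInt_two_add_div (n : ℕ) :
    -qInt 2 + qInt (n + 1 : ℕ) / qInt (n + 2 : ℕ) = -(qInt (n + 3 : ℕ) / qInt (n + 2 : ℕ)) := by
  have ne_zero := qInt_ne_zero (k := n + 2) (by omega)
  field_simp
  linear_combination -qInt_two_mul_qInt_succ (n + 1)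

theorem hook_clasp_hook {p n : ℕ} (h : p + (n + 1) < m)
    (kills : Kills (clasp (m := m) p n (by omega)) p n) (x : WebSpace m) :
    hook (p + n) (clasp p (n + 1) h.le (hook (p + n) x)) =
      -(qInt (n + 2 : ℕ) / qInt (n + 1 : ℕ)) • clasp p n (by omega) (hook (p + n) x) := by
  have hook_hook (y : WebSpace m) : hook (p + n) (hook (p + n) y) = -qInt 2 • hook (p + n) y := by
    rw [qInt_two]
    exact LinearMap.congr_fun (hook_mul_self (p + n)) y
  cases n with
  | zero =>
    have one : qInt (0 + 1 : ℕ) = 1 := div_self brace_one_ne_zero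
    rw [one, div_one]
    exact hook_hook x
  | succ n =>
    have zigzag (y : WebSpace m) :
        hook (p + (n + 1)) (hook (p + n) (hook (p + (n + 1)) y)) = hook (p + (n + 1)) y :=
      LinearMap.congr_fun (hook_succ_mul_hook_mul_hook_succ (i := p + n) (by omega)) y
    have commute := clasp_hook (m := m) (p := p) (n := n + 1) (i := p + (n + 1)) (by omega)
      (.inr le_rfl)
    have loop : hook (p + (n + 1)) (clasp p (n + 1) (by omega) (hook (p + (n + 1)) x)) =
        -qInt 2 • clasp p (n + 1) (by omega) (hook (p + (n + 1)) x) := by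
      rw [← commute, hook_hook, map_smul]
    have straighten : hook (p + (n + 1)) (clasp p (n + 1) (by omega)
        (hook (p + n) (clasp p (n + 1) (by omega) (hook (p + (n + 1)) x)))) =
        clasp p (n + 1) (by omega) (hook (p + (n + 1)) x) := by
      rw [commute x, ← commute, zigzag, ← commute, kills.clasp_apply]
    rw [clasp_add_two, map_add, map_smul, loop, straighten, ← add_smul,
      neg_qInt_two_add_div]

theorem kills_clasp {p n : ℕ} (h : p + n ≤ m) : Kills (clasp p n h) p n := by
  induction n using Nat.twoStepInduction with
  | zero => exact fun i hi => absurd hi (by omega)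
  | one => exact fun i hi => absurd hi (by omega)
  | more n ih ih' =>
    intro i hi x
    have smaller := ih' (by omega)
    rw [clasp_add_two]
    rcases Nat.lt_or_ge (i + 1) (n + 1) with inner | outer
    · rw [smaller i inner, map_zero, map_zero, smul_zero, add_zero]
    · obtain rfl : i = n := by omega
      have numerator := qInt_ne_zero (k := i + 1) (by omega)
      have denominator := qInt_ne_zero (k := i + 2) (by omega)
      have absorb : Kills (clasp (m := m) p (i + 1) (by omega)) p i :=
        smaller.mono (k := 0) (by omega)
      rw [hook_clasp_hook (by omega) (ih (by omega)), map_smul, absorb.clasp_apply, smul_smul,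
        mul_neg, div_mul_div_cancel₀' numerator, div_self denominator, neg_smul, one_smul,
        add_neg_cancel]

end Clasp

section NestedArcs

/-- The web of `m / 2` nested arcs on an even number `m` of marked points (`0` if `m` is odd). -/
def nest : (m : ℕ) → WebSpace m
  | 0 => Finsupp.single BasisWeb.empty 1
  | 1 => 0
  | m + 2 => cup (m / 2) (nest m)

theorem nest_two_mul_add_two (l : ℕ) : nest (2 * l + 2) = cup l (nest (2 * l)) := by
  rw [nest, Nat.mul_div_cancel_left l two_pos]

theorem cap_nest {i : ℕ} (hm : Even m) (hi : 2 * i ≤ m) :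
    cap i (nest (m + 4)) = cup (m - i) (nest m) := by
  obtain ⟨l, rfl⟩ := even_iff_exists_two_mul.1 hm
  clear hm
  induction l with
  | zero =>
    obtain rfl : i = 0 := by omega
    exact cap_cup_succ (by omega) _
  | succ l ih =>
    have outermost : nest (2 * (l + 1) + 4) = cup (l + 2) (nest (2 * (l + 1) + 2)) :=
      nest_two_mul_add_two (l + 2)
    rw [outermost]
    rcases Nat.lt_or_ge l i with middle | outer
    · obtain rfl : i = l + 1 := by omega
      rw [nest_two_mul_add_two, cap_cup_succ (by omega),
        show 2 * (l + 1) - (l + 1) = l + 1 by omega]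
    · rw [cap_cup (.left outer), show 2 * (l + 1) - i = 2 * l - i + 2 by omega]
      calc
        _ = cup l (cup (2 * l - i) (nest (2 * l))) := congrArg _ (ih (by omega))
        _ = cup (2 * l - i + 2) (cup l (nest (2 * l))) :=
          (cup_cup (.left (show l ≤ 2 * l - i by omega)) _).symm
        _ = _ := congrArg _ (nest_two_mul_add_two l).symm

theorem Kills.cup_apply {V : Type*} [AddCommGroup V] [Module K V] {φ : WebSpace (m + 2) →ₗ[K] V}
    {p N i : ℕ} (hφ : Kills φ p N) (hp : p + i ≤ m) (hi : i + 1 < N) (x : WebSpace m) :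
    φ (cup (p + i) x) = 0 := by
  have closed := hφ i hi (cup (p + i) x)
  rw [hook_apply, cap_cup_self hp, map_smul, map_smul, smul_eq_zero] at closed
  exact closed.resolve_left (neg_ne_zero.2 (qInt_ne_zero two_ne_zero))

/-- Turnbacks slide along the nested arcs to the mirror image positions. -/
theorem Kills.hook_nest {V : Type*} [AddCommGroup V] [Module K V] {φ : WebSpace m →ₗ[K] V}
    {p N i : ℕ} (hm : Even m) (hp : 2 * (p + N) ≤ m) (hφ : Kills φ (m - p - N) N)
    (hi : i + 1 < N) : φ (hook (p + i) (nest m)) = 0 := by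
  obtain ⟨m, rfl⟩ := Nat.exists_eq_add_of_le' (show 4 ≤ m by omega)
  have mirror : m - (p + i) + 2 = m + 4 - p - N + (N - 2 - i) := by omega
  rw [hook_apply, cap_nest (by simpa [parity_simps] using hm) (by omega),
    ← cup_cup (.left (show p + i ≤ m - (p + i) by omega)), mirror]
  exact hφ.cup_apply (by omega) (by omega) _

theorem killed_apply_nest {m' p p' N : ℕ} {L : WebSpace m →ₗ[K] WebSpace m'} (hm : Even m)
    (hp : 2 * (p + N) ≤ m) (hL : Intertwines L p p' N) (hk : Kills L (m - p - N) N) :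
    Killed (L (nest m)) p' N :=
  fun i hi => (hL i hi _).symm.trans (hk.hook_nest hm hp hi)

/-- A family of webs, one for each number of marked points. Computing in such families avoids
transport along equations between numbers of marked points. -/
abbrev WebFamily : Type := (m : ℕ) → WebSpace m

/-- The arc insertion `cup i` on families of webs. -/
def familyCup (i : ℕ) (x : WebFamily) : WebFamily
  | m + 2 => cup i (x m)
  | _ => 0

/-- The insertion of `l` nested arcs in front of the marked point with number `p` in a family of
webs. -/
def arches (p : ℕ) : ℕ → WebFamily → WebFamily
  | 0, x => x
  | l + 1, x => familyCup (p + l) (arches p l x)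

theorem familyCup_familyCup {i j : ℕ} (h : i ≤ j) (x : WebFamily) :
    familyCup i (familyCup j x) = familyCup (j + 2) (familyCup i x) := by
  funext m
  match m with
  | 0 | 1 => rfl
  | 2 | 3 => exact (map_zero _).trans (map_zero _).symm
  | m + 4 => exact (cup_cup (.left h) (x m)).symm

theorem familyCup_arches {i p : ℕ} (h : i ≤ p) (l : ℕ) (x : WebFamily) :
    familyCup i (arches p l x) = arches (p + 2) l (familyCup i x) := by
  induction l with
  | zero => rfl
  | succ l ih => rw [arches, familyCup_familyCup (by omega), ih, add_right_comm]; rfl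

theorem nestedTurnback_cup {j M c : ℕ} (h : M + j ≤ c) (x : WebSpace m) :
    nestedTurnback j M (m + 2) (cup c x) = cup c (nestedTurnback j M m x) := by
  induction j generalizing M c m with
  | zero => rfl
  | succ j ih =>
    cases M with
    | zero => exact (map_zero _).symm
    | succ M =>
      rcases Nat.lt_or_ge m 2 with hm | hm
      · simp [cup_of_lt (show m < c by omega)]
      · obtain ⟨m, rfl⟩ := Nat.exists_eq_add_of_le' hm
        obtain ⟨c, rfl⟩ := Nat.exists_eq_add_of_le' (show 2 ≤ c by omega)
        simp only [nestedTurnback, LinearMap.comp_apply]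
        rw [cap_cup (.left (by omega)), ih (by omega), cup_cup (.left (by omega))]

theorem intertwines_nestedTurnback {j M p : ℕ} (h : M + j ≤ p) (N : ℕ) :
    Intertwines (nestedTurnback j M m) p p N := by
  intro i _
  induction j generalizing M p m with
  | zero => exact fun x => rfl
  | succ j ih =>
    match M, m with
    | 0, _ | _ + 1, 0 | _ + 1, 1 => exact fun x => (map_zero _).symm
    | M + 1, m + 2 =>
      intro x
      obtain ⟨p, rfl⟩ := Nat.exists_eq_add_of_le' (show 2 ≤ p by omega)
      simp only [nestedTurnback, LinearMap.comp_apply]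
      rw [add_right_comm, cap_hook (.left (by omega)), ih (by omega),
        hook_cup (.right (show M ≤ p + i by omega))]

theorem nestedTurnback_nest (k j : ℕ) :
    nestedTurnback j (k + j) (4 * (k + j)) (nest (4 * (k + j))) =
      arches (k + 2 * j + 2 * k) j (arches k j nest) (4 * (k + j)) := by
  induction j with
  | zero => rfl
  | succ j ih =>
    have mirror : 4 * (k + j) - (k + j) = k + 2 * j + 2 * k + j := by omega
    calc
      _ = cup (k + j) (nestedTurnback j (k + j) (4 * (k + j) + 2)
            (cap (k + j) (nest (4 * (k + j) + 4)))) := rfl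
      _ = cup (k + j) (cup (k + 2 * j + 2 * k + j)
            (arches (k + 2 * j + 2 * k) j (arches k j nest) (4 * (k + j)))) := by
        rw [cap_nest ⟨2 * (k + j), by omega⟩ (by omega), nestedTurnback_cup (by omega), ih, mirror]
      _ = familyCup (k + j) (arches (k + 2 * j + 2 * k) (j + 1) (arches k j nest))
            (4 * (k + j) + 4) := rfl
      _ = arches (k + 2 * j + 2 * k + 2) (j + 1) (arches k (j + 1) nest) (4 * (k + j) + 4) := by
        rw [familyCup_arches (by omega)]; rfl
      _ = _ := by
        rw [show k + 2 * j + 2 * k + 2 = k + 2 * (j + 1) + 2 * k by ring]; rfl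

end NestedArcs

section Bracket

theorem bracket_cast {x : WebFamily} {D : TangleDiagram m} (hD : bracket D = x m) {m' : ℕ}
    (h : m = m') : bracket (D.cast h) = x m' := by
  subst h
  exact hD

theorem bracket_arcs {x : WebFamily} {D : TangleDiagram m} (hD : bracket D = x m) {p : ℕ}
    (hp : p ≤ m) (l : ℕ) : bracket (D.arcs p hp l) = arches p l x (m + 2 * l) := by
  induction l with
  | zero => exact hD
  | succ l ih =>
    rw [TangleDiagram.arcs, bracket, ih, birth_eq_cup]
    rfl

theorem bracket_empty_arcs (l : ℕ) :
    bracket (TangleDiagram.empty.arcs 0 le_rfl l) = nest (0 + 2 * l) := by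
  induction l with
  | zero => rfl
  | succ l ih =>
    rw [TangleDiagram.arcs, bracket, ih, birth_eq_cup]
    exact congrArg (cup · (nest (0 + 2 * l))) (show 0 + l = (0 + 2 * l) / 2 by omega)

theorem bracket_slide (p b : ℕ) (h : p + b < m) (D : TangleDiagram m) :
    bracket (D.slide p b h) = slideR crossing p b (bracket D) := by
  induction b with
  | zero => rfl
  | succ b ih =>
    rw [slideR, Module.End.mul_apply, ← ih (by omega), crossing_apply,
      ← turnback_eq_hook (by omega)]
    rfl

theorem bracket_cableCross (p b a : ℕ) (h : p + a + b ≤ m) (D : TangleDiagram m) :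
    bracket (D.cableCross p b a h) = bandCrossing crossing p b a (bracket D) := by
  induction a generalizing D with
  | zero => rfl
  | succ a ih => rw [TangleDiagram.cableCross, ih, bracket_slide]; rfl

theorem bracket_fullTwist (n : ℕ) :
    bracket (TangleDiagram.fullTwist n) = twist crossing 0 n n (nest (4 * n)) := by
  rw [TangleDiagram.fullTwist, bracket_cableCross, bracket_cableCross,
    bracket_cast (bracket_empty_arcs _),
    ← bandCrossing_mul_bandCrossing fun _ _ => crossing_commute]
  rfl

theorem bracket_through {n k : ℕ} (hk : k ≤ n) :
    bracket (TangleDiagram.through n k hk) =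
      nestedTurnback (n - k) n (4 * n) (nest (4 * n)) := by
  obtain ⟨j, rfl⟩ := Nat.exists_eq_add_of_le hk
  rw [TangleDiagram.through,
    bracket_cast (bracket_arcs (bracket_arcs (bracket_empty_arcs _) _ _) _ _),
    Nat.add_sub_cancel_left, nestedTurnback_nest]

end Bracket

section FullTwist

theorem q4_pow_mul_qShiftedPoch_mul_qPoch (k j : ℕ) :
    q4 ^ (4 * (k * j) + 2 * (j * (j + 1))) * qShiftedPoch (k + j) j * qPoch k = qPoch (k + j) := by
  induction j with
  | zero => simp [qShiftedPoch]
  | succ j ih =>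
    have hq := pow_ne_zero (k + j + 1) q_ne_zero
    rw [← add_assoc, qShiftedPoch_succ_succ, qPoch_succ, ← ih]
    have exponent : q4 ^ (4 * (k * (j + 1)) + 2 * ((j + 1) * (j + 1 + 1))) =
        q4 ^ (4 * (k * j) + 2 * (j * (j + 1))) * q ^ (k + j + 1) := by
      rw [q, ← pow_mul, ← pow_add]
      ring_nf
    rw [exponent]
    field_simp

theorem twistCoeff_self {n k : ℕ} (hk : k ≤ n) :
    twistCoeff n n (n - k) =
      (-1) ^ (n - k) * q4 ^ (2 * (2 * (k : ℤ) ^ 2 - (n : ℤ) ^ 2 + (k : ℤ) - (n : ℤ))) *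
        (qPoch n / qPoch k) * qBinom n k := by
  obtain ⟨j, rfl⟩ := Nat.exists_eq_add_of_le hk
  have hq4 := q4_ne_zero
  have hPk := qPoch_ne_zero k
  have hPj := qPoch_ne_zero j
  have exponent : q4 ^ (2 * (2 * (k : ℤ) ^ 2 - ((k + j : ℕ) : ℤ) ^ 2 + k - (k + j : ℕ))) =
      q4 ^ (2 * ((k + j) * (k + j)) + 2 * j) / (q4 ^ (4 * (k * j) + 2 * (j * (j + 1)))) ^ 2 := by
    rw [← pow_mul, ← zpow_natCast, ← zpow_natCast, ← zpow_sub₀ hq4]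
    congr 1
    push_cast
    ring
  rw [Nat.add_sub_cancel_left, twistCoeff, qBinom, if_pos hk, Nat.add_sub_cancel_left, exponent,
    ← q4_pow_mul_qShiftedPoch_mul_qPoch k j, neg_pow, ← pow_mul, pow_add]
  field_simp

/-- The clasps at the right ends of the two bands of `n` strands, where the bands cross. -/
def rightClasps (n : ℕ) : WebSpace (4 * n) →ₗ[K] WebSpace (4 * n) :=
  clasp 0 n (by omega) ∘ₗ clasp n n (by omega)

/-- The clasps at the left ends of the two bands of `n` strands. -/
def leftClasps (n : ℕ) : WebSpace (4 * n) →ₗ[K] WebSpace (4 * n) :=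
  clasp (2 * n) n (by omega) ∘ₗ clasp (3 * n) n (by omega)

theorem kills_rightClasps_lower (n : ℕ) : Kills (rightClasps n) 0 n :=
  (intertwines_clasp (by omega) (.inl (by omega))).kills (kills_clasp (by omega))

theorem kills_rightClasps_upper (n : ℕ) : Kills (rightClasps n) n n :=
  (kills_clasp (by omega)).comp _

theorem kills_leftClasps_upper (n : ℕ) : Kills (leftClasps n) (2 * n) n :=
  (intertwines_clasp (by omega) (.inl (by omega))).kills (kills_clasp (by omega))

theorem kills_leftClasps_lower (n : ℕ) : Kills (leftClasps n) (3 * n) n :=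
  (kills_clasp (by omega)).comp _

theorem intertwines_leftClasps (n : ℕ) : Intertwines (leftClasps n) 0 0 (2 * n) :=
  (intertwines_clasp (by omega) (.inl (by omega))).comp
    (intertwines_clasp (by omega) (.inl (by omega)))

theorem nestedTurnback_leftClasps {n j : ℕ} (hj : j ≤ n) (x : WebSpace (4 * n)) :
    nestedTurnback j n (4 * n) (leftClasps n x) = leftClasps n (nestedTurnback j n (4 * n) x) := by
  rw [leftClasps, LinearMap.comp_apply, LinearMap.comp_apply,
    (intertwines_nestedTurnback (by omega) n).clasp _ (by omega),
    (intertwines_nestedTurnback (by omega) n).clasp _ (by omega)]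

theorem claspedBands_nest (n : ℕ) :
    ClaspedBands 0 n n (leftClasps n (nest (4 * n))) (rightClasps n) where
  fits := by omega
  killed_left := by
    refine killed_apply_nest (p := 0) ⟨2 * n, by omega⟩ (by omega)
      ((intertwines_leftClasps n).mono (k := 0) (by omega)) ?_
    rw [show 4 * n - 0 - n = 3 * n by omega]
    exact kills_leftClasps_lower n
  killed_right := by
    refine killed_apply_nest (p := 0 + n) ⟨2 * n, by omega⟩ (by omega)
      ((intertwines_leftClasps n).mono (k := n) (by omega)) ?_
    rw [show 4 * n - (0 + n) - n = 2 * n by omega]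
    exact kills_leftClasps_upper n
  kills_left := kills_rightClasps_lower n
  kills_right := by
    rw [zero_add]
    exact kills_rightClasps_upper n

theorem clasped_fullTwist (n : ℕ) :
    clasped n (bracket (TangleDiagram.fullTwist n)) =
      ∑ j ∈ Finset.range (n + 1),
        twistCoeff n n j • clasped n (nestedTurnback j n (4 * n) (nest (4 * n))) := by
  calc
    _ = rightClasps n (twist crossing 0 n n (leftClasps n (nest (4 * n)))) := by
      rw [bracket_fullTwist, ← (intertwines_leftClasps n).twist (by omega)]
      rfl
    _ = ∑ j ∈ Finset.range (n + 1), twistCoeff n n j •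
          rightClasps n (nestedTurnback j n (4 * n) (leftClasps n (nest (4 * n)))) := by
      rw [ClaspedBands.twist_eq_sum n (claspedBands_nest n), zero_add]
    _ = _ := Finset.sum_congr rfl fun j hj => by
      rw [nestedTurnback_leftClasps (by simpa [Nat.lt_succ_iff] using hj)]
      rfl

end FullTwist

end A1Web

end

theorem mainTheorem9 (n : ℕ) :
    A1Web.clasped n (A1Web.bracket (A1Web.TangleDiagram.fullTwist n)) =
      ∑ k : Fin (n + 1),
        ((-1) ^ (n - k.val) *
            A1Web.q4 ^ (2 * (2 * (k.val : ℤ) ^ 2 - (n : ℤ) ^ 2 + (k.val : ℤ) - (n : ℤ))) *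
            (A1Web.qPoch n / A1Web.qPoch k.val) * A1Web.qBinom n k.val) •
          A1Web.clasped n
            (A1Web.bracket (A1Web.TangleDiagram.through n k.val (Nat.le_of_lt_succ k.isLt))) := by
  rw [A1Web.clasped_fullTwist, ← Finset.sum_range_reflect, Finset.sum_range]
  refine Finset.sum_congr rfl fun k _ => ?_
  have hk := Nat.le_of_lt_succ k.isLt
  rw [Nat.add_sub_cancel, A1Web.twistCoeff_self hk, A1Web.bracket_through hk]
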